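/- Let $p$ be an odd prime and let $\{1,\sigma\}$ be a group of order $2$. Let $G$ be a pro-$p$-group that is free on finitely many generators, endowed with an action of $\{1,\sigma\}$ by continuous automorphisms. Let $\mathrm{Fr}(G)$ be the Frattini subgroup of $G$, i.e. the closed subgroup generated by all $p$-th powers and all commutators, and let $d_G^{+}$ and $d_G^{-}$ denote the dimensions over $\mathbb{F}_p$ of the subspaces of $G/\mathrm{Fr}(G)$ on which $\sigma$ acts by $+1$ and by $-1$, respectively. Let $N$ be an open $\sigma$-invariant normal subgroup of $G$, and set $\Delta := (G/N)\rtimes\{1,\sigma\}$. Let $N_{\rm ab}$ be the quotient of $N$ by the closure of its commutator subgroup, with its canonical structure of a $\mathbb{Z}_p$-module and with the $\mathbb{Z}_p$-linear action of $\Delta$ induced by the conjugation of $G$ on $N$ and by the action of $\sigma$ on $N$. For $\epsilon\in\{\pm1\}$ let $V_\epsilon := \mathbb{Q}_p[\Delta](\sigma+\epsilon)$, a left submodule of the group ring $\mathbb{Q}_p[\Delta]$, and write $V_+:=V_{+1}$, $V_-:=V_{-1}$. Let $\mathbb{Q}_p$ carry the trivial representation of $\Delta$. Then: (a) There exists an isomorphism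 of $\mathbb{Q}_p[\Delta]$-modules $$(N_{\rm ab}\otimes_{\mathbb{Z}_p}\mathbb{Q}_p)\oplus V_+\ \cong\ \mathbb{Q}_p\oplus V_+^{\oplus d_G^+}\oplus V_-^{\oplus d_G^-}.$$ (b) The $\mathbb{Q}_p[G/N]$-module $N_{\rm ab}\otimes_{\mathbb{Z}_p}\mathbb{Q}_p$ is generated by $d_G^+$ even and $d_G^-$ odd elements, i.e. there exist $v_1,\dots,v_{d_G^+}$ with $\sigma v_i=v_i$ and $w_1,\dots,w_{d_G^-}$ with $\sigma w_j=-w_j$ which together generate it over $\mathbb{Q}_p[G/N]$. -/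

import Mathlib

open scoped TensorProduct Topology commutatorElement

universe u

noncomputable section

/-! ### Pro-`p` groups -/

/-- A profinite group `G` is a pro-`p` group if every quotient of `G` by an open normal subgroup
is a `p`-group. The conditions that `G` is a compact totally disconnected topological group
are kept as separate type classes. -/
class IsProP (p : ℕ) (G : Type*) [Group G] [TopologicalSpace G] : Prop where
  isPGroup_quotient (p) : ∀ U : OpenNormalSubgroup G, IsPGroup p (G ⧸ (U : Subgroup G))

/-- The pro-`p` group `G` is free on the finitely many elements `x 0, …, x (n - 1)`: for all
`h 0, …, h (n - 1)` in a pro-`p` group `H` there is a unique continuous homomorphism `G → H`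
that maps each `x i` to `h i`. -/
def IsFreeProPOn (p : ℕ) {G : Type u} [Group G] [TopologicalSpace G] {n : ℕ} (x : Fin n → G) :
    Prop :=
  ∀ (H : Type u) [Group H] [TopologicalSpace H] [IsTopologicalGroup H] [CompactSpace H]
    [TotallyDisconnectedSpace H] [IsProP p H] (h : Fin n → H),
    ∃! φ : G →ₜ* H, ∀ i, φ (x i) = h i

/-- Auxiliary: in `A` the maps `a ↦ a ^ (p ^ M)` tend to `1` uniformly. -/
class PowTendsToOne (p : ℕ) (A : Type*) [Group A] [TopologicalSpace A] : Prop where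
  exists_pow_mem (p) : ∀ U ∈ 𝓝 (1 : A), ∃ M : ℕ, ∀ a : A, a ^ p ^ M ∈ U

instance IsProP.powTendsToOne (p : ℕ) [Fact p.Prime] (G : Type*) [Group G] [TopologicalSpace G]
    [IsTopologicalGroup G] [CompactSpace G] [TotallyDisconnectedSpace G] [IsProP p G] :
    PowTendsToOne p G where
  exists_pow_mem U hU := by
    obtain ⟨W, hWU, hWo, hW1⟩ := mem_nhds_iff.1 hU
    obtain ⟨H, hH⟩ := ProfiniteGrp.exist_openNormalSubgroup_sub_open_nhds_of_one hWo hW1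
    have : Finite (G ⧸ (H : Subgroup G)) :=
      Subgroup.quotient_finite_of_isOpen _ H.toOpenSubgroup.isOpen
    obtain ⟨M, hM⟩ := IsPGroup.iff_card.1 (IsProP.isPGroup_quotient p H)
    refine ⟨M, fun a => hWU (hH ?_)⟩
    have h : ((a : G ⧸ (H : Subgroup G))) ^ p ^ M = 1 := by rw [← hM]; exact pow_card_eq_one'
    rw [← QuotientGroup.mk_pow, QuotientGroup.eq_one_iff] at h
    exact h

instance PowTendsToOne.subgroup (p : ℕ) (G : Type*) [Group G] [TopologicalSpace G]
    [PowTendsToOne p G] (N : Subgroup G) : PowTendsToOne p N where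
  exists_pow_mem U hU := by
    obtain ⟨V, hV, hVU⟩ := (mem_nhds_subtype _ _ _).1 hU
    obtain ⟨M, hM⟩ := PowTendsToOne.exists_pow_mem p V hV
    exact ⟨M, fun a => hVU (hM a)⟩

instance PowTendsToOne.quotient (p : ℕ) (G : Type*) [Group G] [TopologicalSpace G]
    [PowTendsToOne p G] (N : Subgroup G) [N.Normal] : PowTendsToOne p (G ⧸ N) where
  exists_pow_mem U hU := by
    obtain ⟨M, hM⟩ := PowTendsToOne.exists_pow_mem p ((QuotientGroup.mk : G → G ⧸ N) ⁻¹' U)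
      (QuotientGroup.continuous_mk.continuousAt.preimage_mem_nhds hU)
    refine ⟨M, fun a => ?_⟩
    obtain ⟨g, rfl⟩ := QuotientGroup.mk_surjective a
    exact hM g

/-! ### The canonical `ℤ_p`-module structure of an abelian pro-`p` group -/

section PadicModule

open Filter

variable {p : ℕ} [Fact p.Prime]

/-- `p`-adic powers `a ^ z = lim a ^ (z mod p ^ n)`. -/
def padicPow {A : Type*} [CommGroup A] [TopologicalSpace A] (z : ℤ_[p]) (a : A) : A :=
  haveI : Nonempty A := ⟨1⟩
  limUnder atTop fun n => a ^ z.appr n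

variable {A : Type*} [CommGroup A] [TopologicalSpace A] [PowTendsToOne p A]

theorem padic_pow_div_mem (p : ℕ) [Fact p.Prime] {A : Type*} [CommGroup A] [TopologicalSpace A]
    [PowTendsToOne p A] {U : Set A} (hU : U ∈ 𝓝 1) : ∃ M : ℕ, ∀ (a : A) (k l : ℕ),
    (k : ℤ_[p]) - l ∈ Ideal.span {(p : ℤ_[p]) ^ M} → a ^ k / a ^ l ∈ U := by
  obtain ⟨M, hM⟩ := PowTendsToOne.exists_pow_mem p U hU
  refine ⟨M, fun a k l h => ?_⟩
  have h' : (p : ℤ) ^ M ∣ (k : ℤ) - l := by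
    rw [← PadicInt.norm_int_le_pow_iff_dvd]
    push_cast
    exact (PadicInt.norm_le_pow_iff_mem_span_pow _ _).2 h
  obtain ⟨c, hc⟩ := h'
  have : a ^ k / a ^ l = (a ^ c) ^ p ^ M := by
    rw [← zpow_natCast, ← zpow_natCast, ← zpow_natCast, div_eq_mul_inv, ← zpow_sub, hc,
      ← zpow_mul]
    push_cast
    rw [mul_comm]
  rw [this]
  exact hM _

theorem padic_span_mono {z : ℤ_[p]} {m n : ℕ} (h : m ≤ n)
    (hz : z ∈ Ideal.span {(p : ℤ_[p]) ^ n}) : z ∈ Ideal.span {(p : ℤ_[p]) ^ m} :=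
  Ideal.span_singleton_le_span_singleton.2 (pow_dvd_pow _ h) hz

variable [IsTopologicalGroup A] [CompactSpace A]

theorem tendsto_padicPow_aux (z : ℤ_[p]) (a : A) :
    ∃ l : A, Tendsto (fun n => a ^ z.appr n) atTop (𝓝 l) := by
  obtain ⟨l, hl⟩ := exists_clusterPt_of_compactSpace (map (fun n => a ^ z.appr n) atTop)
  refine ⟨l, fun W hW => ?_⟩
  have hmul : Tendsto (fun x : A × A => x.1 * x.2) (𝓝 1 ×ˢ 𝓝 l) (𝓝 l) := by
    have := (continuous_mul (M := A)).tendsto (1, l)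
    rwa [nhds_prod_eq, one_mul] at this
  obtain ⟨U, hU, V, hV, hUV⟩ := mem_prod_iff.1 (hmul hW)
  obtain ⟨M, hM⟩ := padic_pow_div_mem p hU
  have hfreq := mapClusterPt_iff_frequently.1 hl V hV
  obtain ⟨m, hmM, hm⟩ := frequently_atTop.1 hfreq M
  refine mem_map.2 (mem_atTop_sets.2 ⟨M, fun n hn => ?_⟩)
  have key : a ^ z.appr n / a ^ z.appr m ∈ U := by
    refine hM a _ _ ?_
    have h1 := padic_span_mono hn (PadicInt.appr_spec n z)
    have h2 := padic_span_mono hmM (PadicInt.appr_spec m z)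
    have := Ideal.sub_mem _ h2 h1
    rwa [sub_sub_sub_cancel_left] at this
  have : (a ^ z.appr n / a ^ z.appr m, a ^ z.appr m) ∈ U ×ˢ V := ⟨key, hm⟩
  simpa using hUV this

theorem tendsto_padicPow (z : ℤ_[p]) (a : A) :
    Tendsto (fun n => a ^ z.appr n) atTop (𝓝 (padicPow z a)) :=
  tendsto_nhds_limUnder (tendsto_padicPow_aux z a)

theorem tendsto_padicPow_of_congr {z : ℤ_[p]} (a : A) {k : ℕ → ℕ}
    (hk : ∀ n, z - k n ∈ Ideal.span {(p : ℤ_[p]) ^ n}) :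
    Tendsto (fun n => a ^ k n) atTop (𝓝 (padicPow z a)) := by
  have h1 : Tendsto (fun n => a ^ k n / a ^ z.appr n) atTop (𝓝 1) := by
    intro U hU
    obtain ⟨M, hM⟩ := padic_pow_div_mem p hU
    refine mem_map.2 (mem_atTop_sets.2 ⟨M, fun n hn => hM a _ _ ?_⟩)
    have := Ideal.sub_mem _ (padic_span_mono hn (PadicInt.appr_spec n z))
      (padic_span_mono hn (hk n))
    rwa [sub_sub_sub_cancel_left] at this
  simpa using h1.mul (tendsto_padicPow z a)

variable [T2Space A]

theorem padicPow_natCast_mul (k : ℕ) (z : ℤ_[p]) (a : A) :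
    padicPow ((k : ℤ_[p]) * z) a = padicPow z a ^ k := by
  have h1 := (tendsto_padicPow z a).pow k
  have h2 : Tendsto (fun n => a ^ (k * z.appr n)) atTop (𝓝 (padicPow ((k : ℤ_[p]) * z) a)) := by
    refine tendsto_padicPow_of_congr a fun n => ?_
    have := Ideal.mul_mem_left _ (k : ℤ_[p]) (PadicInt.appr_spec n z)
    push_cast
    rwa [mul_sub] at this
  refine tendsto_nhds_unique h2 (h1.congr fun n => ?_)
  rw [← pow_mul, mul_comm]

theorem tendsto_padicPow_padic {z : ℤ_[p]} (a : A) {y : ℕ → ℤ_[p]}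
    (hy : ∀ n, z - y n ∈ Ideal.span {(p : ℤ_[p]) ^ n}) :
    Tendsto (fun n => padicPow (y n) a) atTop (𝓝 (padicPow z a)) := by
  have h1 : Tendsto (fun n => padicPow (y n) a / padicPow z a) atTop (𝓝 1) := by
    refine (closed_nhds_basis (1 : A)).tendsto_right_iff.2 fun U ⟨hU, hUc⟩ => ?_
    obtain ⟨M, hM⟩ := padic_pow_div_mem p hU
    refine eventually_atTop.2 ⟨M, fun n hn => ?_⟩
    refine hUc.mem_of_tendsto ((tendsto_padicPow (y n) a).div' (tendsto_padicPow z a)) ?_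
    refine eventually_atTop.2 ⟨M, fun m hm => hM a _ _ ?_⟩
    have e1 := padic_span_mono hm (PadicInt.appr_spec m z)
    have e2 := padic_span_mono hm (PadicInt.appr_spec m (y n))
    have e3 := padic_span_mono hn (hy n)
    have := Ideal.sub_mem _ (Ideal.sub_mem _ e1 e2) e3
    convert this using 1
    ring
  simpa using h1.mul_const (padicPow z a)

/-- The canonical `ℤ_p`-module structure of an abelian pro-`p` group, written additively:
`z • a` is the limit of `(z mod p ^ n) • a`. -/
instance padicModule : Module ℤ_[p] (Additive A) where
  smul z a := Additive.ofMul (padicPow z a.toMul)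
  one_smul a := by
    refine congrArg Additive.ofMul (?_ : padicPow (1 : ℤ_[p]) a.toMul = a.toMul)
    refine tendsto_nhds_unique (tendsto_padicPow_of_congr (k := fun _ => 1) _ fun n => by simp) ?_
    simp
  mul_smul z w a := by
    refine congrArg Additive.ofMul
      (?_ : padicPow (z * w) a.toMul = padicPow z (padicPow w a.toMul))
    refine tendsto_nhds_unique (tendsto_padicPow_padic (y := fun n => (z.appr n : ℤ_[p]) * w) _
      fun n => ?_) ((tendsto_padicPow z _).congr fun n => (padicPow_natCast_mul _ _ _).symm)
    rw [← sub_mul]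
    exact Ideal.mul_mem_right _ _ (PadicInt.appr_spec n z)
  smul_zero z := by
    refine congrArg Additive.ofMul (?_ : padicPow z (1 : A) = 1)
    refine tendsto_nhds_unique (tendsto_padicPow z _) ?_
    simp
  zero_smul a := by
    refine congrArg Additive.ofMul (?_ : padicPow (0 : ℤ_[p]) a.toMul = 1)
    refine tendsto_nhds_unique (tendsto_padicPow_of_congr (k := fun _ => 0) _ fun n => by simp) ?_
    simp
  smul_add z a b := by
    refine congrArg Additive.ofMul
      (?_ : padicPow z (a.toMul * b.toMul) = padicPow z a.toMul * padicPow z b.toMul)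
    refine tendsto_nhds_unique (tendsto_padicPow z _) ?_
    simp_rw [mul_pow]
    exact (tendsto_padicPow z _).mul (tendsto_padicPow z _)
  add_smul z w a := by
    refine congrArg Additive.ofMul
      (?_ : padicPow (z + w) a.toMul = padicPow z a.toMul * padicPow w a.toMul)
    refine tendsto_nhds_unique
      (tendsto_padicPow_of_congr (k := fun n => z.appr n + w.appr n) _ fun n => ?_) ?_
    · have := Ideal.add_mem _ (PadicInt.appr_spec n z) (PadicInt.appr_spec n w)
      push_cast
      convert this using 1
      ring
    · simp_rw [pow_add]
      exact (tendsto_padicPow z _).mul (tendsto_padicPow w _)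

/-- A continuous homomorphism of abelian pro-`p` groups is `ℤ_p`-linear. -/
def padicLinearMap (p : ℕ) [Fact p.Prime] {A B : Type*}
    [CommGroup A] [TopologicalSpace A] [PowTendsToOne p A] [IsTopologicalGroup A] [CompactSpace A]
    [T2Space A] [CommGroup B] [TopologicalSpace B] [PowTendsToOne p B] [IsTopologicalGroup B]
    [CompactSpace B] [T2Space B] (f : A →ₜ* B) : Additive A →ₗ[ℤ_[p]] Additive B where
  toFun a := Additive.ofMul (f a.toMul)
  map_add' a b := congrArg Additive.ofMul (map_mul f a.toMul b.toMul)
  map_smul' z a := by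
    refine congrArg Additive.ofMul
      (?_ : f (padicPow z a.toMul) = padicPow z (f a.toMul))
    refine tendsto_nhds_unique
      ((f.continuous_toFun.tendsto _).comp (tendsto_padicPow z a.toMul)) ?_
    refine (tendsto_padicPow z _).congr fun n => ?_
    exact (map_pow f _ _).symm

end PadicModule

/-! ### Topological abelianization -/

/-- A continuous homomorphism induces a continuous homomorphism of topological abelianizations. -/
def topAbMap {A B : Type*} [Group A] [TopologicalSpace A] [IsTopologicalGroup A]
    [Group B] [TopologicalSpace B] [IsTopologicalGroup B] (f : A →ₜ* B) :
    TopologicalAbelianization A →ₜ* TopologicalAbelianization B where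
  toMonoidHom := QuotientGroup.map _ _ f.toMonoidHom (by
    refine Subgroup.topologicalClosure_minimal _ ?_
      ((Subgroup.isClosed_topologicalClosure _).preimage f.continuous_toFun)
    refine le_trans ?_ (Subgroup.comap_mono (Subgroup.le_topologicalClosure _))
    rw [← Subgroup.map_le_iff_le_comap, commutator_def, Subgroup.map_commutator]
    exact Subgroup.commutator_mono le_top le_top)
  continuous_toFun := continuous_quot_lift _
    (QuotientGroup.continuous_mk.comp f.continuous_toFun)

instance (A : Type*) [Group A] [TopologicalSpace A] [IsTopologicalGroup A] :
    T2Space (TopologicalAbelianization A) :=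
  haveI : IsClosed ((commutator A).topologicalClosure : Set A) :=
    Subgroup.isClosed_topologicalClosure _
  inferInstance

instance {G : Type*} [Group G] [TopologicalSpace G] [IsTopologicalGroup G] [CompactSpace G]
    (N : OpenNormalSubgroup G) : CompactSpace (N : Subgroup G) :=
  isCompact_iff_compactSpace.1
    (Subgroup.isClosed_of_isOpen _ N.toOpenSubgroup.isOpen).isCompact

/-! ### Actions of the group `{1, σ}` -/

/-- The group `{1, σ}` of order two. -/
abbrev SigmaGroup : Type := Multiplicative (ZMod 2)

/-- The non-trivial element of `{1, σ}`. -/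
abbrev sigma : SigmaGroup := Multiplicative.ofAdd 1

/-- The subgroup `N` is invariant under the action of `{1, σ}`. -/
class SigmaInvariant {G : Type*} [Group G] [MulDistribMulAction SigmaGroup G] (N : Subgroup G) :
    Prop where
  smul_mem : ∀ (s : SigmaGroup), ∀ g ∈ N, s • g ∈ N

section Action

variable {G : Type*} [Group G] [MulDistribMulAction SigmaGroup G]

instance (N : Subgroup G) [SigmaInvariant N] : MulAction.QuotientAction SigmaGroup N where
  inv_mul_mem s a b h := by
    rw [← smul_inv', ← smul_mul']
    exact SigmaInvariant.smul_mem s _ h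

/-- The action of `{1, σ}` on `G ⧸ N`, given by `s • [g] = [s • g]`. -/
instance quotientSigmaAction (N : Subgroup G) [N.Normal] [SigmaInvariant N] :
    MulDistribMulAction SigmaGroup (G ⧸ N) where
  smul_mul s a b := by
    obtain ⟨a, rfl⟩ := QuotientGroup.mk_surjective a
    obtain ⟨b, rfl⟩ := QuotientGroup.mk_surjective b
    rw [← QuotientGroup.mk_mul, MulAction.Quotient.smul_coe, MulAction.Quotient.smul_coe,
      MulAction.Quotient.smul_coe, ← QuotientGroup.mk_mul, smul_mul']
  smul_one s := by
    rw [← QuotientGroup.mk_one, MulAction.Quotient.smul_coe, smul_one]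

/-- The group `Δ = (G / N) ⋊ {1, σ}`. -/
abbrev Delta (N : Subgroup G) [N.Normal] [SigmaInvariant N] : Type _ :=
  (G ⧸ N) ⋊[MulDistribMulAction.toMulAut SigmaGroup (G ⧸ N)] SigmaGroup

/-- The element `σ` of `Δ`. -/
abbrev deltaSigma (N : Subgroup G) [N.Normal] [SigmaInvariant N] : Delta N :=
  SemidirectProduct.inr sigma

/-- The left submodule `V_ε = ℚ_p[Δ](σ + ε)` of the group ring `ℚ_p[Δ]`. -/
abbrev VSign (p : ℕ) [Fact p.Prime] (N : Subgroup G) [N.Normal] [SigmaInvariant N] (ε : ℤˣ) :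
    Submodule (MonoidAlgebra ℚ_[p] (Delta N)) (MonoidAlgebra ℚ_[p] (Delta N)) :=
  Submodule.span (MonoidAlgebra ℚ_[p] (Delta N))
    {MonoidAlgebra.of ℚ_[p] (Delta N) (deltaSigma N) + ((ε : ℤ) : MonoidAlgebra ℚ_[p] (Delta N))}

end Action

/-! ### The invariants `d_G^+` and `d_G^-` -/

section Frattini

variable (p : ℕ) (G : Type*) [Group G] [TopologicalSpace G] [IsTopologicalGroup G]

/-- The Frattini subgroup of a pro-`p` group: the closed subgroup generated by all `p`-th powers
and all commutators. -/
def proPFrattini : Subgroup G :=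
  (Subgroup.closure (Set.range fun g : G => g ^ p) ⊔ commutator G).topologicalClosure

/-- The Frattini subgroup is mapped into itself by continuous endomorphisms. -/
theorem proPFrattini_le_comap (f : G →* G) (hf : Continuous f) :
    proPFrattini p G ≤ (proPFrattini p G).comap f := by
  refine Subgroup.topologicalClosure_minimal _ ?_
    ((Subgroup.isClosed_topologicalClosure _).preimage hf)
  refine le_trans ?_ (Subgroup.comap_mono (Subgroup.le_topologicalClosure _))
  refine sup_le ?_ ?_
  · rw [Subgroup.closure_le]
    rintro _ ⟨g, rfl⟩
    refine Subgroup.mem_sup_left (Subgroup.subset_closure ⟨f g, ?_⟩)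
    simp
  · refine le_trans ?_ (Subgroup.comap_mono le_sup_right)
    rw [← Subgroup.map_le_iff_le_comap, commutator_def, Subgroup.map_commutator]
    exact Subgroup.commutator_mono le_top le_top

instance : (proPFrattini p G).Normal where
  conj_mem n hn g :=
    proPFrattini_le_comap p G (MulAut.conj g).toMonoidHom
      (show Continuous fun x : G => g * x * g⁻¹ by fun_prop) hn

instance [MulDistribMulAction SigmaGroup G] [ContinuousConstSMul SigmaGroup G] :
    SigmaInvariant (proPFrattini p G) where
  smul_mem s _ hg :=
    proPFrattini_le_comap p G (MulDistribMulAction.toMonoidHom G s) (continuous_const_smul s) hg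

instance frattiniQuotientCommGroup : CommGroup (G ⧸ proPFrattini p G) where
  mul_comm x y := by
    obtain ⟨a, rfl⟩ := QuotientGroup.mk_surjective x
    obtain ⟨b, rfl⟩ := QuotientGroup.mk_surjective y
    rw [← QuotientGroup.mk_mul, ← QuotientGroup.mk_mul, QuotientGroup.eq]
    have h : (a * b)⁻¹ * (b * a) = ⁅b⁻¹, a⁻¹⁆ := by group
    rw [h]
    exact Subgroup.le_topologicalClosure _ (Subgroup.mem_sup_right
      (Subgroup.commutator_mem_commutator (Subgroup.mem_top _) (Subgroup.mem_top _)))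
  __ : Group (G ⧸ proPFrattini p G) := inferInstance

/-- The `𝔽_p`-vector space structure of `G / Fr(G)`, written additively. -/
instance frattiniQuotientModule : Module (ZMod p) (Additive (G ⧸ proPFrattini p G)) :=
  AddCommGroup.zmodModule fun x => by
    obtain ⟨a, ha⟩ := QuotientGroup.mk_surjective x.toMul
    refine congrArg Additive.ofMul (?_ : x.toMul ^ p = 1)
    rw [← ha, ← QuotientGroup.mk_pow, QuotientGroup.eq_one_iff]
    exact Subgroup.le_topologicalClosure _
      (Subgroup.mem_sup_left (Subgroup.subset_closure ⟨a, rfl⟩))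

variable [MulDistribMulAction SigmaGroup G] [ContinuousConstSMul SigmaGroup G]

/-- The action of `σ` on the `𝔽_p`-vector space `G / Fr(G)`. -/
def frattiniSigma : Module.End (ZMod p) (Additive (G ⧸ proPFrattini p G)) :=
  AddMonoidHom.toZModLinearMap p
    (MonoidHom.toAdditive (MulDistribMulAction.toMonoidHom (G ⧸ proPFrattini p G) sigma))

/-- `d_G^ε` is the dimension over `𝔽_p` of the part of `G / Fr(G)` on which `σ` acts by `ε`. -/
def dSign (ε : ℤˣ) : ℕ :=
  Module.finrank (ZMod p) ((frattiniSigma p G).eigenspace ((ε : ℤ) : ZMod p))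

end Frattini

/-! ### The representation of `Δ` on `N_ab ⊗ ℚ_p` -/

section Representation

variable (p : ℕ) [Fact p.Prime] {G : Type*} [Group G] [TopologicalSpace G] [IsTopologicalGroup G]
  [CompactSpace G] [TotallyDisconnectedSpace G] [IsProP p G]

/-- The `ℤ_p`-module `N_ab`, the abelianization of `N` as a pro-`p` group, written additively. -/
abbrev NAb (N : OpenNormalSubgroup G) : Type _ :=
  Additive (TopologicalAbelianization (N : Subgroup G))

/-- The class in `N_ab` of an element of `N`. -/
def NAb.mk (N : OpenNormalSubgroup G) (x : (N : Subgroup G)) : NAb N :=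
  Additive.ofMul (QuotientGroup.mk x)

theorem NAb.mk_surjective (N : OpenNormalSubgroup G) : Function.Surjective (NAb.mk N) :=
  fun x => QuotientGroup.mk_surjective (s := (commutator (N : Subgroup G)).topologicalClosure) x.toMul

/-- The `ℤ_p`-linear endomorphism of `N_ab` induced by a continuous endomorphism of `N`. -/
def nAbEnd (N : OpenNormalSubgroup G) (f : (N : Subgroup G) →ₜ* (N : Subgroup G)) :
    Module.End ℤ_[p] (NAb N) :=
  padicLinearMap p (topAbMap f)

theorem nAbEnd_mk (N : OpenNormalSubgroup G) (f : (N : Subgroup G) →ₜ* (N : Subgroup G))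
    (x : (N : Subgroup G)) : nAbEnd p N f (NAb.mk N x) = NAb.mk N (f x) := rfl

/-- Conjugation by `g` on `N`. -/
def conjHom (N : OpenNormalSubgroup G) (g : G) : (N : Subgroup G) →ₜ* (N : Subgroup G) where
  toMonoidHom := (MulAut.conjNormal g).toMonoidHom
  continuous_toFun := by
    refine Continuous.subtype_mk ?_ _
    exact (continuous_const.mul continuous_subtype_val).mul continuous_const

theorem conjHom_coe (N : OpenNormalSubgroup G) (g : G) (x : (N : Subgroup G)) :
    (conjHom N g x : G) = g * x * g⁻¹ := rfl

/-- The action of `G / N` on `N_ab` induced by conjugation. -/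
def conjRep (N : OpenNormalSubgroup G) :
    (G ⧸ (N : Subgroup G)) →* Module.End ℤ_[p] (NAb N) :=
  QuotientGroup.lift (N : Subgroup G)
    { toFun := fun g => nAbEnd p N (conjHom N g)
      map_one' := by
        refine LinearMap.ext fun x => ?_
        obtain ⟨x, rfl⟩ := NAb.mk_surjective N x
        rw [nAbEnd_mk]
        refine congrArg (NAb.mk N) (Subtype.ext ?_)
        simp [conjHom_coe]
      map_mul' := fun g h => by
        refine LinearMap.ext fun x => ?_
        obtain ⟨x, rfl⟩ := NAb.mk_surjective N x
        rw [Module.End.mul_apply, nAbEnd_mk, nAbEnd_mk, nAbEnd_mk]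
        refine congrArg (NAb.mk N) (Subtype.ext ?_)
        simp only [conjHom_coe]
        group }
    (fun g hg => by
      refine LinearMap.ext fun x => ?_
      obtain ⟨x, rfl⟩ := NAb.mk_surjective N x
      refine congrArg Additive.ofMul (QuotientGroup.eq.2 (Subgroup.le_topologicalClosure _ ?_))
      have : (conjHom N g x)⁻¹ * x = ⁅(⟨g, hg⟩ : (N : Subgroup G)), x⁻¹⁆ := by
        refine Subtype.ext ?_
        simp only [Subgroup.coe_mul, Subgroup.coe_inv, conjHom_coe, commutatorElement_def]
        group
      exact this ▸ Subgroup.commutator_mem_commutator (Subgroup.mem_top _) (Subgroup.mem_top _))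

theorem conjRep_mk (N : OpenNormalSubgroup G) (g : G) (x : (N : Subgroup G)) :
    conjRep p N (g : G ⧸ (N : Subgroup G)) (NAb.mk N x) = NAb.mk N (MulAut.conjNormal g x) := rfl

variable [MulDistribMulAction SigmaGroup G] [ContinuousConstSMul SigmaGroup G]

/-- The action of an element of `{1, σ}` on `N`. -/
def sigmaHom (N : OpenNormalSubgroup G) [SigmaInvariant (N : Subgroup G)] (s : SigmaGroup) :
    (N : Subgroup G) →ₜ* (N : Subgroup G) where
  toFun x := ⟨s • (x : G), SigmaInvariant.smul_mem s _ x.2⟩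
  map_one' := Subtype.ext (smul_one s)
  map_mul' x y := Subtype.ext (smul_mul' s (x : G) y)
  continuous_toFun := (continuous_subtype_val.const_smul s).subtype_mk _

/-- The action of `{1, σ}` on `N_ab`. -/
def sigmaRep (N : OpenNormalSubgroup G) [SigmaInvariant (N : Subgroup G)] :
    SigmaGroup →* Module.End ℤ_[p] (NAb N) where
  toFun s := nAbEnd p N (sigmaHom N s)
  map_one' := by
    refine LinearMap.ext fun x => ?_
    obtain ⟨x, rfl⟩ := NAb.mk_surjective N x
    exact congrArg (NAb.mk N) (Subtype.ext (one_smul _ (x : G)))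
  map_mul' s t := by
    refine LinearMap.ext fun x => ?_
    obtain ⟨x, rfl⟩ := NAb.mk_surjective N x
    exact congrArg (NAb.mk N) (Subtype.ext (mul_smul s t (x : G)))

theorem sigmaRep_comp_conjRep (N : OpenNormalSubgroup G) [SigmaInvariant (N : Subgroup G)]
    (s : SigmaGroup) (a : G ⧸ (N : Subgroup G)) :
    sigmaRep p N s * conjRep p N a = conjRep p N (s • a) * sigmaRep p N s := by
  refine LinearMap.ext fun x => ?_
  obtain ⟨x, rfl⟩ := NAb.mk_surjective N x
  obtain ⟨g, rfl⟩ := QuotientGroup.mk_surjective a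
  refine congrArg (NAb.mk N) (Subtype.ext ?_)
  change s • (g * (x : G) * g⁻¹) = (s • g) * (s • (x : G)) * (s • g)⁻¹
  rw [smul_mul', smul_mul', smul_inv']

/-- The action of `Δ = (G / N) ⋊ {1, σ}` on `N_ab`, in which `G / N` acts through conjugation:
`([g], s)` maps the class of `x` to the class of `g (s • x) g⁻¹`. -/
def nAbRep (N : OpenNormalSubgroup G) [SigmaInvariant (N : Subgroup G)] :
    Representation ℤ_[p] (Delta (N : Subgroup G)) (NAb N) where
  toFun d := conjRep p N d.left * sigmaRep p N d.right
  map_one' := by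
    rw [SemidirectProduct.one_left, SemidirectProduct.one_right, map_one, map_one, mul_one]
  map_mul' d e := by
    rw [SemidirectProduct.mul_left, SemidirectProduct.mul_right, map_mul, map_mul,
      MulDistribMulAction.toMulAut_apply, MulDistribMulAction.toMulEquiv_apply, mul_assoc,
      ← mul_assoc (conjRep p N (d.right • e.left)), ← sigmaRep_comp_conjRep]
    simp only [mul_assoc]

theorem nAbRep_mk (N : OpenNormalSubgroup G) [SigmaInvariant (N : Subgroup G)] (g : G)
    (s : SigmaGroup) (x : (N : Subgroup G)) :
    nAbRep p N ⟨(g : G ⧸ (N : Subgroup G)), s⟩ (NAb.mk N x) =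
      NAb.mk N (MulAut.conjNormal g (sigmaHom N s x)) := rfl

/-- The representation of `Δ` on the `ℚ_p`-vector space `N_ab ⊗ ℚ_p` (tensor product over
`ℤ_p`). -/
def nAbRepQ (N : OpenNormalSubgroup G) [SigmaInvariant (N : Subgroup G)] :
    Representation ℚ_[p] (Delta (N : Subgroup G)) (ℚ_[p] ⊗[ℤ_[p]] NAb N) :=
  (Module.End.baseChangeHom ℤ_[p] ℚ_[p] (NAb N) : _ →* _).comp (nAbRep p N)

/-- The restriction of this representation to `G / N`. -/
def nAbRepQuot (N : OpenNormalSubgroup G) [SigmaInvariant (N : Subgroup G)] :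
    Representation ℚ_[p] (G ⧸ (N : Subgroup G)) (ℚ_[p] ⊗[ℤ_[p]] NAb N) :=
  (nAbRepQ p N).comp SemidirectProduct.inl

end Representation

end

/-!
Let `Q = G / N`, let `x 0, …, x (n - 1)` be free generators of `G`, and let `M` be the free
`ℤ_p[Q]`-module on them. By freeness there is a continuous crossed homomorphism `d : G → M` that
maps `x i` to the `i`-th basis element (`MagnusDerivation`). It is universal, so `{1, σ}` acts on
`M` in such a way that `d` is equivariant (`MagnusDerivation.rep`), and it restricts on `N` to a
`Δ`-equivariant map `N_ab → M`. Over `ℚ_p` this map is the beginning of an exact sequence of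
`ℚ_p[Δ]`-modules

  `0 → N_ab ⊗ ℚ_p → M ⊗ ℚ_p → ℚ_p[Q] → ℚ_p → 0`,

in which `d (x i)` is mapped to `x i - 1`. The map on `N_ab` is injective because a transfer
argument gives a crossed homomorphism `G → N_ab` whose restriction to `N` is multiplication by the
order of `Q`, and this factors through `d` (`MagnusDerivation.exists_comp_restrict`). Exactness in
the middle comes from a homotopy given by the values of `d` on coset representatives
(`MagnusDerivation.sub_homotopy_boundary_mem_range`).

It remains to determine `M` with its action of `Δ`. The coinvariants of `M` modulo `p` are
`G / Fr(G)`, by `d`. Since `p` is odd, a basis of eigenvectors of `σ` in `G / Fr(G)` lifts to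
eigenvectors of `σ` in `M`, and by Nakayama's lemma for the finite `p`-group `Q` these form a basis
of `M` over `ℤ_p[Q]` (`MagnusDerivation.exists_eigenbasis`). Hence `M ⊗ ℚ_p` is a direct sum of
`d_G^+` copies of `V_+` and `d_G^-` copies of `V_-`, and in the same way `ℚ_p[Q]` is `V_+`
(`VSign.nonempty_pi_linearEquiv`). By Maschke's theorem the exact sequence splits, which is (a), and
a retraction of `N_ab ⊗ ℚ_p → M ⊗ ℚ_p` maps the basis vectors of `M` to the generators in (b).
-/

set_option linter.unusedSectionVars false

/-! ### Topological generation and continuous crossed homomorphisms -/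

/-- A group is pro-`p` as soon as each of its elements has `p`-power powers near `1`. -/
theorem IsProP.of_exists_pow_mem {p : ℕ} {H : Type*} [Group H] [TopologicalSpace H]
    (h : ∀ U ∈ 𝓝 (1 : H), ∀ a : H, ∃ k : ℕ, a ^ p ^ k ∈ U) : IsProP p H where
  isPGroup_quotient U a := by
    obtain ⟨a, rfl⟩ := QuotientGroup.mk_surjective a
    obtain ⟨k, hk⟩ := h U (U.toOpenSubgroup.isOpen.mem_nhds (one_mem U)) a
    refine ⟨k, ?_⟩
    rw [← QuotientGroup.mk_pow, QuotientGroup.eq_one_iff]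
    exact hk

/-- A function `D` on a group is a crossed homomorphism to the representation `ρ` if
`D (g h) = D g + g · D h`. -/
def IsCrossedHom {k G W : Type*} [CommRing k] [Group G] [AddCommGroup W] [Module k W]
    (ρ : Representation k G W) (D : G → W) : Prop :=
  ∀ g h, D (g * h) = D g + ρ g (D h)

namespace IsCrossedHom

variable {k G W : Type*} [CommRing k] [Group G] [AddCommGroup W] [Module k W]
  {ρ : Representation k G W} {D D' : G → W}

theorem map_one (hD : IsCrossedHom ρ D) : D 1 = 0 := by
  simpa using hD 1 1

theorem map_inv (hD : IsCrossedHom ρ D) (g : G) : D g⁻¹ = -ρ g⁻¹ (D g) := by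
  have := hD g⁻¹ g
  rw [inv_mul_cancel, hD.map_one] at this
  exact eq_neg_of_add_eq_zero_left this.symm

/-- The elements on which two crossed homomorphisms agree form a subgroup. -/
def eqLocus (hD : IsCrossedHom ρ D) (hD' : IsCrossedHom ρ D') : Subgroup G where
  carrier := {g | D g = D' g}
  one_mem' := hD.map_one.trans hD'.map_one.symm
  mul_mem' {a b} ha hb := by
    simp only [Set.mem_ofPred_eq] at *
    rw [hD, hD', ha, hb]
  inv_mem' {a} ha := by
    simp only [Set.mem_ofPred_eq] at *
    rw [hD.map_inv, hD'.map_inv, ha]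

theorem eq_of_topologicalClosure_eq_top [TopologicalSpace G] [IsTopologicalGroup G]
    [TopologicalSpace W] [T2Space W] {S : Set G}
    (hS : (Subgroup.closure S).topologicalClosure = ⊤) (hD : IsCrossedHom ρ D)
    (hD' : IsCrossedHom ρ D') (hc : Continuous D) (hc' : Continuous D')
    (h : Set.EqOn D D' S) : D = D' := by
  have hle : (Subgroup.closure S).topologicalClosure ≤ hD.eqLocus hD' :=
    Subgroup.topologicalClosure_minimal _ ((Subgroup.closure_le _).2 h) (isClosed_eq hc hc')
  funext g
  exact hle (hS ▸ Subgroup.mem_top g)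

end IsCrossedHom

/-- The semidirect product `W ⋊ Q` of a representation `W` of `Q`, the second component acting on
the first. -/
@[ext]
structure RepSemidirect {k Q W : Type*} [CommRing k] [Group Q] [AddCommGroup W] [Module k W]
    (ρ : Representation k Q W) where
  /-- The component in the representation. -/
  left : W
  /-- The component in the group. -/
  right : Q

namespace RepSemidirect

variable {k Q W : Type*} [CommRing k] [Group Q] [AddCommGroup W] [Module k W]
  {ρ : Representation k Q W}

instance : Mul (RepSemidirect ρ) := ⟨fun a b => ⟨a.left + ρ a.right b.left, a.right * b.right⟩⟩
instance : One (RepSemidirect ρ) := ⟨⟨0, 1⟩⟩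
instance : Inv (RepSemidirect ρ) := ⟨fun a => ⟨-ρ a.right⁻¹ a.left, a.right⁻¹⟩⟩

@[simp] theorem mul_left (a b : RepSemidirect ρ) : (a * b).left = a.left + ρ a.right b.left := rfl
@[simp] theorem mul_right (a b : RepSemidirect ρ) : (a * b).right = a.right * b.right := rfl
@[simp] theorem one_left : (1 : RepSemidirect ρ).left = 0 := rfl
@[simp] theorem one_right : (1 : RepSemidirect ρ).right = 1 := rfl
@[simp] theorem inv_left (a : RepSemidirect ρ) : a⁻¹.left = -ρ a.right⁻¹ a.left := rfl
@[simp] theorem inv_right (a : RepSemidirect ρ) : a⁻¹.right = a.right⁻¹ := rfl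

instance : Group (RepSemidirect ρ) :=
  Group.ofLeftAxioms (fun a b c => by ext <;> simp [add_assoc, mul_assoc])
    (fun a => by ext <;> simp) (fun a => by ext <;> simp)

variable (ρ) in
/-- The projection onto `Q`. -/
def rightHom : RepSemidirect ρ →* Q where
  toFun := right
  map_one' := rfl
  map_mul' _ _ := rfl

theorem pow_eq_of_right_eq_one {a : RepSemidirect ρ} (ha : a.right = 1) (m : ℕ) :
    a ^ m = ⟨m • a.left, 1⟩ := by
  induction m with
  | zero => ext <;> simp
  | succ m ih => rw [pow_succ, ih]; ext <;> simp [ha, succ_nsmul]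

variable [TopologicalSpace W] [TopologicalSpace Q]

/-- The topology of `W ⋊ Q` is the product topology. -/
instance : TopologicalSpace (RepSemidirect ρ) :=
  TopologicalSpace.induced (fun a => (a.left, a.right)) inferInstance

variable (ρ) in
/-- As a topological space, `W ⋊ Q` is the product of `W` and `Q`. -/
def homeomorphProd : RepSemidirect ρ ≃ₜ W × Q where
  toFun a := (a.left, a.right)
  invFun b := ⟨b.1, b.2⟩
  continuous_toFun := continuous_induced_dom
  continuous_invFun := continuous_induced_rng.2 continuous_id

theorem continuous_left : Continuous (left : RepSemidirect ρ → W) :=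
  continuous_fst.comp (homeomorphProd ρ).continuous

theorem continuous_right : Continuous (right : RepSemidirect ρ → Q) :=
  continuous_snd.comp (homeomorphProd ρ).continuous

theorem isTopologicalGroup [IsTopologicalAddGroup W] [DiscreteTopology Q]
    (hρ : ∀ q, Continuous (ρ q)) : IsTopologicalGroup (RepSemidirect ρ) := by
  have act : Continuous fun a : Q × W => ρ a.1 a.2 := continuous_prod_of_discrete_left.2 hρ
  have hl := continuous_left (ρ := ρ)
  have hr := continuous_right (ρ := ρ)
  refine { continuous_mul := continuous_induced_rng.2 (Continuous.prodMk ?_ ?_),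
           continuous_inv := continuous_induced_rng.2 (Continuous.prodMk ?_ ?_) }
  · exact (hl.comp continuous_fst).add
      (act.comp ((hr.comp continuous_fst).prodMk (hl.comp continuous_snd)))
  · exact continuous_of_discreteTopology.comp
      ((hr.comp continuous_fst).prodMk (hr.comp continuous_snd)) (g := fun a : Q × Q => a.1 * a.2)
  · exact (act.comp ((continuous_of_discreteTopology.comp hr (g := fun a : Q => a⁻¹)).prodMk
      hl)).neg
  · exact continuous_of_discreteTopology.comp hr (g := fun a : Q => a⁻¹)

theorem isProP {p : ℕ} (hQ : IsPGroup p Q)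
    (hW : ∀ w : W, Filter.Tendsto (fun m : ℕ => p ^ m • w) Filter.atTop (𝓝 0)) :
    IsProP p (RepSemidirect ρ) := by
  refine IsProP.of_exists_pow_mem fun U hU a => ?_
  obtain ⟨m, hm⟩ := hQ a.right
  have h1 : (a ^ p ^ m).right = 1 := (map_pow (rightHom ρ) a _).trans hm
  have h2 := (homeomorphProd ρ).symm.continuous.tendsto (0, 1)
  have h3 : Filter.Tendsto (fun l : ℕ => (p ^ l • (a ^ p ^ m).left, (1 : Q))) Filter.atTop
      (𝓝 (0, 1)) := (hW _).prodMk_nhds tendsto_const_nhds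
  obtain ⟨l, hl⟩ := ((h2.comp h3).eventually_mem hU).exists
  -- `a ^ p ^ m` lies in `W`, where the `p`-power multiples tend to zero
  refine ⟨m + l, ?_⟩
  rw [pow_add, pow_mul, pow_eq_of_right_eq_one h1]
  exact hl

end RepSemidirect

theorem PadicInt.tendsto_pow_smul {p : ℕ} [Fact p.Prime] {W : Type*} [AddCommGroup W]
    [Module ℤ_[p] W] [TopologicalSpace W] [ContinuousSMul ℤ_[p] W] (w : W) :
    Filter.Tendsto (fun m : ℕ => p ^ m • w) Filter.atTop (𝓝 0) := by
  have h : Filter.Tendsto (fun m : ℕ => (p : ℤ_[p]) ^ m) Filter.atTop (𝓝 0) :=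
    tendsto_pow_atTop_nhds_zero_of_norm_lt_one ((PadicInt.norm_lt_one_iff_dvd _).2 dvd_rfl)
  have := h.smul_const w
  rw [zero_smul] at this
  refine this.congr fun m => ?_
  rw [← Nat.cast_pow, Nat.cast_smul_eq_nsmul]

section Free

variable {p : ℕ} {G : Type u} [Group G] [TopologicalSpace G]

/-- Free generators generate topologically: the closed subgroup `H` that they generate is pro-`p`,
and by uniqueness the composite of the induced homomorphism `G → H` with the inclusion of `H` is the
identity. -/
theorem IsFreeProPOn.topologicalClosure_eq_top [Fact p.Prime] [IsTopologicalGroup G]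
    [CompactSpace G] [TotallyDisconnectedSpace G] [IsProP p G] {n : ℕ} {x : Fin n → G}
    (hx : IsFreeProPOn p x) :
    (Subgroup.closure (Set.range x)).topologicalClosure = ⊤ := by
  set H := (Subgroup.closure (Set.range x)).topologicalClosure with hH
  have hxH : ∀ i, x i ∈ H := fun i =>
    Subgroup.le_topologicalClosure _ (Subgroup.subset_closure ⟨i, rfl⟩)
  have : CompactSpace H := isCompact_iff_compactSpace.1
    (Subgroup.isClosed_topologicalClosure _).isCompact
  have : IsProP p H := IsProP.of_exists_pow_mem fun U hU a => by
    obtain ⟨M, hM⟩ := PowTendsToOne.exists_pow_mem p U hU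
    exact ⟨M, hM a⟩
  obtain ⟨φ, hφ, -⟩ := hx H fun i => ⟨x i, hxH i⟩
  obtain ⟨ψ, -, hψ⟩ := hx G x
  let ι : H →ₜ* G := ⟨H.subtype, continuous_subtype_val⟩
  have h1 : ι.comp φ = ψ := hψ _ fun i => by
    change ((φ (x i) : H) : G) = x i
    rw [hφ]
  have h2 : ContinuousMonoidHom.id G = ψ := hψ _ fun i => rfl
  refine (Subgroup.eq_top_iff' _).2 fun g => ?_
  have : ι (φ g) = g := DFunLike.congr_fun (h1.trans h2.symm) g
  exact this ▸ (φ g).2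

/-- Crossed homomorphisms on a free pro-`p` group may be prescribed on the free generators: they
are the homomorphisms to a semidirect product, which is again a pro-`p` group. -/
theorem IsFreeProPOn.exists_crossedHom [Fact p.Prime] [IsTopologicalGroup G]
    [CompactSpace G] [TotallyDisconnectedSpace G] [IsProP p G] {n : ℕ} {x : Fin n → G}
    (hx : IsFreeProPOn p x) {Q : Type u} [Group Q] [Finite Q] [TopologicalSpace Q]
    [DiscreteTopology Q] (hQ : IsPGroup p Q) (π : G →ₜ* Q)
    {W : Type u} [AddCommGroup W] [Module ℤ_[p] W] [TopologicalSpace W] [IsTopologicalAddGroup W]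
    [ContinuousSMul ℤ_[p] W] [CompactSpace W] [TotallyDisconnectedSpace W]
    (ρ : Representation ℤ_[p] Q W) (hρ : ∀ q, Continuous (ρ q)) (w : Fin n → W) :
    ∃ D : G → W, Continuous D ∧ IsCrossedHom (ρ.comp (π : G →* Q)) D ∧ ∀ i, D (x i) = w i := by
  have := RepSemidirect.isTopologicalGroup hρ
  have : CompactSpace (RepSemidirect ρ) := (RepSemidirect.homeomorphProd ρ).symm.compactSpace
  have : TotallyDisconnectedSpace (RepSemidirect ρ) :=
    (RepSemidirect.homeomorphProd ρ).symm.totallyDisconnectedSpace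
  have : IsProP p (RepSemidirect ρ) := RepSemidirect.isProP hQ PadicInt.tendsto_pow_smul
  have : IsProP p Q := ⟨fun U => hQ.to_quotient _⟩
  obtain ⟨Φ, hΦ, -⟩ := hx (RepSemidirect ρ) fun i => ⟨w i, π (x i)⟩
  obtain ⟨ψ, -, hψ⟩ := hx Q fun i => π (x i)
  let r : RepSemidirect ρ →ₜ* Q := ⟨RepSemidirect.rightHom ρ, RepSemidirect.continuous_right⟩
  have h1 : r.comp Φ = π := (hψ _ fun i => congrArg RepSemidirect.right (hΦ i)).trans
    (hψ π fun i => rfl).symm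
  refine ⟨fun g => (Φ g).left, RepSemidirect.continuous_left.comp Φ.continuous_toFun,
    fun g h => ?_, fun i => congrArg RepSemidirect.left (hΦ i)⟩
  have h2 : (Φ g).right = π g := DFunLike.congr_fun h1 g
  change (Φ (g * h)).left = _
  rw [map_mul, RepSemidirect.mul_left, h2]
  rfl

end Free

/-! ### Translation representations and the Magnus module -/

section Translation

variable (k ι Q : Type*) [CommRing k] [Group Q]

/-- The free `k[Q]`-module on `ι` as a representation, realized by left translation on the
functions `ι × Q → k`: the indicator function of `(i, r)` stands for the multiple by `r` of the
`i`-th basis element. -/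
def leftTranslation : Representation k Q (ι × Q → k) where
  toFun q := LinearMap.funLeft k k fun a => (a.1, q⁻¹ * a.2)
  map_one' := by ext; simp [LinearMap.funLeft]
  map_mul' q r := by
    refine LinearMap.ext fun f => funext fun a => ?_
    simp [LinearMap.funLeft, mul_assoc]

variable {k ι Q}

theorem leftTranslation_apply (q : Q) (f : ι × Q → k) (a : ι × Q) :
    leftTranslation k ι Q q f a = f (a.1, q⁻¹ * a.2) := rfl

theorem leftTranslation_single [DecidableEq ι] [DecidableEq Q] (q r : Q) (i : ι) (c : k) :
    leftTranslation k ι Q q (Pi.single (i, r) c) = Pi.single (i, q * r) c := by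
  funext a
  simp only [leftTranslation_apply, Pi.single_apply, Prod.ext_iff, inv_mul_eq_iff_eq_mul]

theorem leftTranslation_leftTranslation (q r : Q) (f : ι × Q → k) :
    leftTranslation k ι Q q (leftTranslation k ι Q r f) = leftTranslation k ι Q (q * r) f :=
  (LinearMap.congr_fun (map_mul (leftTranslation k ι Q) q r) f).symm

theorem continuous_leftTranslation [TopologicalSpace k] (q : Q) :
    Continuous (leftTranslation k ι Q q) :=
  continuous_pi fun _ => continuous_apply _

variable (k Q) [MulDistribMulAction SigmaGroup Q]

/-- The permutation representation of `Q ⋊ {1, σ}` on the functions `Q → k`, where `Q` acts on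
itself by left translation and `σ` by its automorphism. -/
def permRep : Representation k (Q ⋊[MulDistribMulAction.toMulAut SigmaGroup Q] SigmaGroup)
    (Q → k) where
  toFun d := LinearMap.funLeft k k fun r => d.right⁻¹ • (d.left⁻¹ * r)
  map_one' := by ext; simp [LinearMap.funLeft]
  map_mul' d e := by
    refine LinearMap.ext fun f => funext fun r => congrArg f ?_
    simp [mul_smul, mul_assoc, smul_mul']

variable {k Q}

theorem permRep_single [DecidableEq Q]
    (d : Q ⋊[MulDistribMulAction.toMulAut SigmaGroup Q] SigmaGroup) (r : Q) (c : k) :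
    permRep k Q d (Pi.single r c) = Pi.single (d.left * d.right • r) c := by
  funext a
  change (Pi.single r c : Q → k) (d.right⁻¹ • (d.left⁻¹ * a)) = _
  simp only [Pi.single_apply, inv_smul_eq_iff, inv_mul_eq_iff_eq_mul]

end Translation

/-- The universal crossed homomorphism attached to topological generators `x i` of `G` and a
homomorphism `π : G → Q`: it takes values in the free `ℤ_p[Q]`-module on the `x i` and maps `x i`
to the `i`-th basis element. The module is called the Magnus module; it is realized as the functions
`Fin n × Q → ℤ_p` on which `Q` acts by `leftTranslation`. -/
structure MagnusDerivation (p : ℕ) [Fact p.Prime] {G Q : Type*} [Group G] [TopologicalSpace G]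
    [IsTopologicalGroup G] [Group Q] [TopologicalSpace Q] [DecidableEq Q] {n : ℕ}
    (x : Fin n → G) (π : G →ₜ* Q) where
  /-- The underlying function. -/
  toFun : G → (Fin n × Q → ℤ_[p])
  continuous_toFun : Continuous toFun
  isCrossedHom : IsCrossedHom ((leftTranslation ℤ_[p] (Fin n) Q).comp (π : G →* Q)) toFun
  map_gen : ∀ i, toFun (x i) = Pi.single (i, 1) 1
  topologicalClosure_eq_top : (Subgroup.closure (Set.range x)).topologicalClosure = ⊤

theorem IsFreeProPOn.nonempty_magnusDerivation {p : ℕ} [Fact p.Prime] {G Q : Type u} [Group G]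
    [TopologicalSpace G] [IsTopologicalGroup G] [CompactSpace G] [TotallyDisconnectedSpace G]
    [IsProP p G] {n : ℕ} {x : Fin n → G} (hx : IsFreeProPOn p x) [Group Q] [Finite Q]
    [TopologicalSpace Q] [DiscreteTopology Q] [DecidableEq Q] (hQ : IsPGroup p Q) (π : G →ₜ* Q) :
    Nonempty (MagnusDerivation p x π) := by
  obtain ⟨D, h1, h2, h3⟩ := hx.exists_crossedHom hQ π (leftTranslation ℤ_[p] (Fin n) Q)
    continuous_leftTranslation fun i => Pi.single (i, 1) 1
  exact ⟨⟨D, h1, h2, h3, hx.topologicalClosure_eq_top⟩⟩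

namespace MagnusDerivation

variable {p : ℕ} [Fact p.Prime] {G Q : Type*} [Group G] [TopologicalSpace G]
    [IsTopologicalGroup G] [Group Q] [TopologicalSpace Q] [DiscreteTopology Q] [Fintype Q]
    [DecidableEq Q] {n : ℕ} {x : Fin n → G} {π : G →ₜ* Q}

instance : CoeFun (MagnusDerivation p x π) fun _ => G → (Fin n × Q → ℤ_[p]) := ⟨toFun⟩

theorem map_mul (d : MagnusDerivation p x π) (g h : G) :
    d (g * h) = d g + leftTranslation ℤ_[p] (Fin n) Q (π g) (d h) :=
  d.isCrossedHom g h

theorem leftTranslation_map_gen (d : MagnusDerivation p x π) (q : Q) (i : Fin n) :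
    leftTranslation ℤ_[p] (Fin n) Q q (d (x i)) = Pi.single (i, q) 1 := by
  rw [d.map_gen, leftTranslation_single, mul_one]

/-- Linear maps on the Magnus module are determined on the translates of the `d (x i)`. -/
theorem linearMap_ext (d : MagnusDerivation p x π) {W : Type*} [AddCommGroup W] [Module ℤ_[p] W]
    {f f' : (Fin n × Q → ℤ_[p]) →ₗ[ℤ_[p]] W}
    (h : ∀ q i, f (leftTranslation ℤ_[p] (Fin n) Q q (d (x i))) =
      f' (leftTranslation ℤ_[p] (Fin n) Q q (d (x i)))) : f = f' := by
  refine (Pi.basisFun ℤ_[p] (Fin n × Q)).ext fun a => ?_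
  rw [Pi.basisFun_apply]
  simpa only [leftTranslation_map_gen] using h a.2 a.1

/-- Crossed homomorphisms factor through the universal one. -/
theorem linearMap_comp_eq (d : MagnusDerivation p x π) {W : Type*} [AddCommGroup W]
    [Module ℤ_[p] W] [TopologicalSpace W] [T2Space W] {ρ : Representation ℤ_[p] G W} {D : G → W}
    (hD : IsCrossedHom ρ D) (hc : Continuous D)
    (f : (Fin n × Q → ℤ_[p]) →ₗ[ℤ_[p]] W) (hfc : Continuous f)
    (hf : ∀ g m, f (leftTranslation ℤ_[p] (Fin n) Q (π g) m) = ρ g (f m))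
    (h : ∀ i, f (d (x i)) = D (x i)) (g : G) : f (d g) = D g := by
  refine congrFun (IsCrossedHom.eq_of_topologicalClosure_eq_top d.topologicalClosure_eq_top
    (D := fun g => f (d g)) (ρ := ρ) (fun g h => ?_) hD
    (hfc.comp d.continuous_toFun) hc ?_) g
  · change f (d (g * h)) = f (d g) + ρ g (f (d h))
    rw [d.map_mul, _root_.map_add, hf]
  · rintro _ ⟨i, rfl⟩
    exact h i

section Sigma

variable [MulDistribMulAction SigmaGroup G] [ContinuousConstSMul SigmaGroup G]
  [MulDistribMulAction SigmaGroup Q]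

/-- The action of `{1, σ}` on the Magnus module, semilinear over `Q` and compatible with the
universal crossed homomorphism. -/
noncomputable def sigmaMap (d : MagnusDerivation p x π) (s : SigmaGroup) :
    Module.End ℤ_[p] (Fin n × Q → ℤ_[p]) :=
  Fintype.linearCombination ℤ_[p] fun a =>
    leftTranslation ℤ_[p] (Fin n) Q (s • a.2) (d (s • x a.1))

theorem sigmaMap_leftTranslation_map_gen (d : MagnusDerivation p x π) (s : SigmaGroup) (q : Q)
    (i : Fin n) : d.sigmaMap s (leftTranslation ℤ_[p] (Fin n) Q q (d (x i))) =
      leftTranslation ℤ_[p] (Fin n) Q (s • q) (d (s • x i)) := by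
  rw [leftTranslation_map_gen, sigmaMap, Fintype.linearCombination_apply_single, one_smul]

theorem sigmaMap_leftTranslation (d : MagnusDerivation p x π) (s : SigmaGroup) (q : Q)
    (m : Fin n × Q → ℤ_[p]) : d.sigmaMap s (leftTranslation ℤ_[p] (Fin n) Q q m) =
      leftTranslation ℤ_[p] (Fin n) Q (s • q) (d.sigmaMap s m) := by
  refine LinearMap.congr_fun (f := d.sigmaMap s ∘ₗ leftTranslation ℤ_[p] (Fin n) Q q)
    (g := leftTranslation ℤ_[p] (Fin n) Q (s • q) ∘ₗ d.sigmaMap s) (d.linearMap_ext ?_) m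
  intro r i
  rw [LinearMap.comp_apply, LinearMap.comp_apply, leftTranslation_leftTranslation,
    sigmaMap_leftTranslation_map_gen, sigmaMap_leftTranslation_map_gen, smul_mul',
    leftTranslation_leftTranslation]

theorem sigmaMap_apply (d : MagnusDerivation p x π)
    (hπ : ∀ (s : SigmaGroup) (g : G), π (s • g) = s • π g) (s : SigmaGroup) (g : G) :
    d.sigmaMap s (d g) = d (s • g) := by
  refine d.linearMap_comp_eq (D := fun g => d (s • g))
    (ρ := (leftTranslation ℤ_[p] (Fin n) Q).comp
      ((π : G →* Q).comp (MulDistribMulAction.toMonoidHom G s))) (fun g h => ?_)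
    (d.continuous_toFun.comp (continuous_const_smul s)) _ (LinearMap.continuous_on_pi _)
    (fun g m => ?_) (fun i => ?_) g
  · change d (s • (g * h)) = _
    rw [smul_mul', d.map_mul]
    rfl
  · rw [sigmaMap_leftTranslation, ← hπ]
    rfl
  · simpa using d.sigmaMap_leftTranslation_map_gen s 1 i

/-- The action of `Q ⋊ {1, σ}` on the Magnus module. -/
noncomputable def rep (d : MagnusDerivation p x π)
    (hπ : ∀ (s : SigmaGroup) (g : G), π (s • g) = s • π g) :
    Representation ℤ_[p] (Q ⋊[MulDistribMulAction.toMulAut SigmaGroup Q] SigmaGroup)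
      (Fin n × Q → ℤ_[p]) where
  toFun a := leftTranslation ℤ_[p] (Fin n) Q a.left * d.sigmaMap a.right
  map_one' := by
    refine d.linearMap_ext fun q i => ?_
    rw [Module.End.mul_apply, SemidirectProduct.one_right, sigmaMap_leftTranslation_map_gen,
      SemidirectProduct.one_left, _root_.map_one, one_smul, one_smul]
  map_mul' a b := by
    refine d.linearMap_ext fun q i => ?_
    simp only [Module.End.mul_apply, SemidirectProduct.mul_left, SemidirectProduct.mul_right,
      sigmaMap_leftTranslation, sigmaMap_apply d hπ, mul_smul, _root_.map_mul]
    rfl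

theorem rep_apply (d : MagnusDerivation p x π)
    (hπ : ∀ (s : SigmaGroup) (g : G), π (s • g) = s • π g)
    (a : Q ⋊[MulDistribMulAction.toMulAut SigmaGroup Q] SigmaGroup) (m : Fin n × Q → ℤ_[p]) :
    d.rep hπ a m = leftTranslation ℤ_[p] (Fin n) Q a.left (d.sigmaMap a.right m) := rfl

end Sigma

/-- The `ℤ_p[Q]`-linear map from the Magnus module to `ℤ_p[Q]` that takes `d (x i)` to
`π (x i) - 1`. The group ring is realized as the functions `Q → ℤ_p`. -/
noncomputable def boundary (_ : MagnusDerivation p x π) :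
    (Fin n × Q → ℤ_[p]) →ₗ[ℤ_[p]] (Q → ℤ_[p]) :=
  Fintype.linearCombination ℤ_[p] fun a => Pi.single (a.2 * π (x a.1)) 1 - Pi.single a.2 1

theorem boundary_leftTranslation_map_gen (d : MagnusDerivation p x π) (q : Q) (i : Fin n) :
    d.boundary (leftTranslation ℤ_[p] (Fin n) Q q (d (x i))) =
      Pi.single (q * π (x i)) 1 - Pi.single q 1 := by
  rw [leftTranslation_map_gen, boundary, Fintype.linearCombination_apply_single, one_smul]

/-- The boundary map is equivariant: on functions on `Q`, left translation by `q` is precomposition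
with multiplication by `q⁻¹`. -/
theorem boundary_leftTranslation (d : MagnusDerivation p x π) (q : Q)
    (m : Fin n × Q → ℤ_[p]) : d.boundary (leftTranslation ℤ_[p] (Fin n) Q q m) =
      LinearMap.funLeft ℤ_[p] ℤ_[p] (q⁻¹ * ·) (d.boundary m) := by
  refine LinearMap.congr_fun (f := d.boundary ∘ₗ leftTranslation ℤ_[p] (Fin n) Q q)
    (g := LinearMap.funLeft ℤ_[p] ℤ_[p] (q⁻¹ * ·) ∘ₗ d.boundary) (d.linearMap_ext ?_) m
  intro r i
  rw [LinearMap.comp_apply, LinearMap.comp_apply, leftTranslation_leftTranslation,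
    boundary_leftTranslation_map_gen, boundary_leftTranslation_map_gen]
  funext a
  simp [LinearMap.funLeft_apply, Pi.single_apply, inv_mul_eq_iff_eq_mul, mul_assoc]

/-- The boundary map turns `d` into the principal crossed homomorphism `g ↦ π g - 1`. -/
theorem boundary_apply (d : MagnusDerivation p x π) (g : G) :
    d.boundary (d g) = Pi.single (π g) 1 - Pi.single 1 1 := by
  refine d.linearMap_comp_eq (D := fun g => Pi.single (π g) 1 - Pi.single 1 1)
    (ρ := (show Representation ℤ_[p] Q (Q → ℤ_[p]) from
      { toFun := fun q => LinearMap.funLeft ℤ_[p] ℤ_[p] (q⁻¹ * ·)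
        map_one' := by ext; simp [LinearMap.funLeft]
        map_mul' := fun q r => by
          ext; simp [LinearMap.funLeft, mul_assoc] }).comp (π : G →* Q))
    (fun g h => ?_) ?_ _ (LinearMap.continuous_on_pi _)
    (fun g m => d.boundary_leftTranslation _ m) (fun i => ?_) g
  · funext a
    simp [LinearMap.funLeft_apply, Pi.single_apply, inv_mul_eq_iff_eq_mul]
  · exact (continuous_of_discreteTopology (f := fun q : Q =>
      (Pi.single q 1 - Pi.single 1 1 : Q → ℤ_[p]))).comp π.continuous_toFun
  · simpa using d.boundary_leftTranslation_map_gen 1 i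

theorem boundary_rep [MulDistribMulAction SigmaGroup G] [ContinuousConstSMul SigmaGroup G]
    [MulDistribMulAction SigmaGroup Q] (d : MagnusDerivation p x π)
    (hπ : ∀ (s : SigmaGroup) (g : G), π (s • g) = s • π g)
    (a : Q ⋊[MulDistribMulAction.toMulAut SigmaGroup Q] SigmaGroup) (m : Fin n × Q → ℤ_[p]) :
    d.boundary (d.rep hπ a m) = permRep ℤ_[p] Q a (d.boundary m) := by
  refine LinearMap.congr_fun (f := d.boundary ∘ₗ d.rep hπ a)
    (g := permRep ℤ_[p] Q a ∘ₗ d.boundary) (d.linearMap_ext ?_) m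
  intro q i
  rw [LinearMap.comp_apply, LinearMap.comp_apply, rep_apply, sigmaMap_leftTranslation_map_gen,
    boundary_leftTranslation, boundary_leftTranslation, boundary_apply,
    boundary_leftTranslation_map_gen, hπ, map_sub (permRep ℤ_[p] Q a), permRep_single,
    permRep_single, smul_mul']
  funext b
  simp [LinearMap.funLeft_apply, Pi.single_apply, inv_mul_eq_iff_eq_mul]

end MagnusDerivation

/-! ### Continuity of the canonical `ℤ_p`-module structure -/

theorem PadicInt.tendsto_appr {p : ℕ} [Fact p.Prime] (z : ℤ_[p]) :
    Filter.Tendsto (fun n => (z.appr n : ℤ_[p])) Filter.atTop (𝓝 z) := by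
  rw [tendsto_iff_norm_sub_tendsto_zero]
  have h : Filter.Tendsto (fun n : ℕ => ((p : ℝ)⁻¹) ^ n) Filter.atTop (𝓝 0) :=
    tendsto_pow_atTop_nhds_zero_of_lt_one (by positivity)
      (inv_lt_one_of_one_lt₀ (by exact_mod_cast (Fact.out : p.Prime).one_lt))
  refine squeeze_zero (fun _ => norm_nonneg _) (fun n => ?_) h
  rw [norm_sub_rev]
  have := (PadicInt.norm_le_pow_iff_mem_span_pow _ _).2 (PadicInt.appr_spec n z)
  rwa [zpow_neg, zpow_natCast, ← inv_pow] at this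

section PadicModule

variable {p : ℕ} [Fact p.Prime] {A : Type*} [CommGroup A] [TopologicalSpace A]
  [PowTendsToOne p A] [IsTopologicalGroup A] [CompactSpace A] [T2Space A]

theorem continuous_padic_smul_const (a : Additive A) : Continuous fun z : ℤ_[p] => z • a := by
  refine continuous_of_continuousAt_zero
    (AddMonoidHom.mk' (fun z : ℤ_[p] => z • a) fun z w => add_smul z w a) ?_
  change Filter.Tendsto (fun z : ℤ_[p] => padicPow z a.toMul) (𝓝 0) (𝓝 (padicPow 0 a.toMul))
  have h0 : padicPow (0 : ℤ_[p]) a.toMul = 1 := congrArg Additive.toMul (zero_smul ℤ_[p] a)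
  rw [h0]
  refine (closed_nhds_basis (1 : A)).tendsto_right_iff.2 fun U ⟨hU, hUc⟩ => ?_
  obtain ⟨M, hM⟩ := padic_pow_div_mem p hU
  have hball : Metric.closedBall (0 : ℤ_[p]) ((p : ℝ) ^ (-M : ℤ)) ∈ 𝓝 0 :=
    Metric.closedBall_mem_nhds _ (zpow_pos (by exact_mod_cast (Fact.out : p.Prime).pos) _)
  filter_upwards [hball] with z hz
  rw [mem_closedBall_zero_iff, PadicInt.norm_le_pow_iff_mem_span_pow] at hz
  refine hUc.mem_of_tendsto (tendsto_padicPow z a.toMul) ?_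
  filter_upwards [Filter.eventually_ge_atTop M] with n hn
  have := hM a.toMul (z.appr n) 0 ?_
  · simpa using this
  · have h1 := padic_span_mono hn (PadicInt.appr_spec n z)
    have := Ideal.sub_mem _ hz h1
    simpa using this

/-- A continuous homomorphism from an abelian pro-`p` group to a topological `ℤ_p`-module is
`ℤ_p`-linear. -/
def AddMonoidHom.toPadicLinearMap {W : Type*} [AddCommGroup W] [Module ℤ_[p] W]
    [TopologicalSpace W] [T2Space W] [ContinuousSMul ℤ_[p] W] (f : Additive A →+ W)
    (hf : Continuous fun a : A => f (Additive.ofMul a)) : Additive A →ₗ[ℤ_[p]] W where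
  __ := f
  map_smul' z a := by
    refine tendsto_nhds_unique ((hf.tendsto _).comp (tendsto_padicPow z a.toMul)) ?_
    refine ((PadicInt.tendsto_appr z).smul_const (f a)).congr fun n => ?_
    rw [Nat.cast_smul_eq_nsmul]
    exact (map_nsmul f _ _).symm

end PadicModule

/-! ### The Magnus embedding of `N_ab` -/

section Transfer

variable {p : ℕ} [Fact p.Prime] {G : Type*} [Group G] [TopologicalSpace G] [IsTopologicalGroup G]
  [CompactSpace G] [TotallyDisconnectedSpace G] [IsProP p G] (N : OpenNormalSubgroup G)

/-- The canonical projection `G → G / N`. -/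
def OpenNormalSubgroup.mkHom : G →ₜ* G ⧸ (N : Subgroup G) where
  toMonoidHom := QuotientGroup.mk' (N : Subgroup G)
  continuous_toFun := QuotientGroup.continuous_mk

instance : DiscreteTopology (G ⧸ (N : Subgroup G)) :=
  QuotientGroup.discreteTopology N.toOpenSubgroup.isOpen

/-- For `g ∈ G` and the chosen representative `t` of a coset, the element of `N` that relates
`g t` to the representative of its coset. -/
noncomputable def cosetDefect (g : G) (q : G ⧸ (N : Subgroup G)) : (N : Subgroup G) :=
  ⟨g * q.out * ((g : G ⧸ (N : Subgroup G)) * q).out⁻¹, by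
    rw [← QuotientGroup.eq_one_iff]
    simp⟩

theorem NAb.mk_mul (x y : (N : Subgroup G)) : NAb.mk N (x * y) = NAb.mk N x + NAb.mk N y := rfl

theorem NAb.continuous_mk : Continuous (NAb.mk N) := QuotientGroup.continuous_mk

theorem cosetDefect_mul (g h : G) (q : G ⧸ (N : Subgroup G)) :
    cosetDefect N (g * h) q =
      MulAut.conjNormal g (cosetDefect N h q) * cosetDefect N g (h * q) := by
  refine Subtype.ext ?_
  simp only [cosetDefect, Subgroup.coe_mul, MulAut.conjNormal_apply, QuotientGroup.mk_mul]
  rw [mul_assoc (g : G ⧸ (N : Subgroup G))]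
  group

theorem continuous_cosetDefect (q : G ⧸ (N : Subgroup G)) :
    Continuous fun g => cosetDefect N g q := by
  refine Continuous.subtype_mk ((continuous_id.mul continuous_const).mul ?_) _
  exact (continuous_of_discreteTopology
    (f := fun r : G ⧸ (N : Subgroup G) => (r * q).out⁻¹)).comp QuotientGroup.continuous_mk

variable [Fintype (G ⧸ (N : Subgroup G))]

/-- The crossed homomorphism `G → N_ab` obtained by summing the coset defects over all cosets.
Its restriction to `N` is multiplication by the index of `N`. -/
noncomputable def transferCrossedHom (g : G) : NAb N :=
  ∑ q : G ⧸ (N : Subgroup G), NAb.mk N (cosetDefect N g q)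

theorem isCrossedHom_transferCrossedHom :
    IsCrossedHom ((conjRep p N).comp (N.mkHom : G →* G ⧸ (N : Subgroup G)))
      (transferCrossedHom N) := by
  intro g h
  have h1 : conjRep p N (g : G ⧸ (N : Subgroup G)) (transferCrossedHom N h) =
      ∑ q, NAb.mk N (MulAut.conjNormal g (cosetDefect N h q)) := by
    rw [transferCrossedHom, map_sum]
    rfl
  change _ = _ + conjRep p N (g : G ⧸ (N : Subgroup G)) (transferCrossedHom N h)
  rw [h1, add_comm]
  simp only [transferCrossedHom, cosetDefect_mul, NAb.mk_mul, Finset.sum_add_distrib]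
  congr 1
  exact Equiv.sum_comp (Equiv.mulLeft (h : G ⧸ (N : Subgroup G)))
    fun q => NAb.mk N (cosetDefect N g q)

theorem continuous_transferCrossedHom : Continuous (transferCrossedHom N) :=
  continuous_finsetSum _ fun q _ => (NAb.continuous_mk N).comp (continuous_cosetDefect N q)

theorem transferCrossedHom_coe (y : (N : Subgroup G)) :
    transferCrossedHom N (y : G) = Fintype.card (G ⧸ (N : Subgroup G)) • NAb.mk N y := by
  have h (q : G ⧸ (N : Subgroup G)) : cosetDefect N (y : G) q = y := by
    refine Subtype.ext ?_
    have h1 : ((y : G) : G ⧸ (N : Subgroup G)) = 1 := (QuotientGroup.eq_one_iff _).2 y.2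
    simp [cosetDefect, h1]
  simp [transferCrossedHom, h]

end Transfer

namespace MagnusDerivation

variable {p : ℕ} [Fact p.Prime] {G : Type*} [Group G] [TopologicalSpace G] [IsTopologicalGroup G]
  [CompactSpace G] [TotallyDisconnectedSpace G] [IsProP p G] {N : OpenNormalSubgroup G}
  [Fintype (G ⧸ (N : Subgroup G))] [DecidableEq (G ⧸ (N : Subgroup G))]
  {n : ℕ} {x : Fin n → G}

theorem map_coe_mul (d : MagnusDerivation p x N.mkHom) (y : (N : Subgroup G)) (g : G) :
    d (y * g) = d y + d g := by
  have h : N.mkHom (y : G) = 1 := (QuotientGroup.eq_one_iff _).2 y.2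
  rw [d.map_mul, h, _root_.map_one]
  rfl

/-- The restriction to `N` of the universal crossed homomorphism, as a linear map on `N_ab`. -/
noncomputable def restrict (d : MagnusDerivation p x N.mkHom) :
    NAb N →ₗ[ℤ_[p]] (Fin n × (G ⧸ (N : Subgroup G)) → ℤ_[p]) :=
  let f : (N : Subgroup G) →* Multiplicative (Fin n × (G ⧸ (N : Subgroup G)) → ℤ_[p]) :=
    MonoidHom.mk' (fun y => Multiplicative.ofAdd (d y)) fun y z => d.map_coe_mul y z
  have hf : Continuous f := d.continuous_toFun.comp continuous_subtype_val
  have hle : (commutator (N : Subgroup G)).topologicalClosure ≤ f.ker :=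
    Subgroup.topologicalClosure_minimal _ (Abelianization.commutator_subset_ker f)
      (isClosed_singleton.preimage hf)
  AddMonoidHom.toPadicLinearMap (MonoidHom.toAdditive (QuotientGroup.lift _ f hle))
    (continuous_quot_lift _ hf)

theorem restrict_mk (d : MagnusDerivation p x N.mkHom) (y : (N : Subgroup G)) :
    d.restrict (NAb.mk N y) = d y := rfl

/-- Conjugation by `g` on `N` corresponds under `d` to the action of `g` on the Magnus module. -/
theorem map_conj (d : MagnusDerivation p x N.mkHom) (g : G) (y : (N : Subgroup G)) :
    d (g * y * g⁻¹) = leftTranslation ℤ_[p] (Fin n) _ (g : G ⧸ (N : Subgroup G)) (d y) := by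
  have h1 : g * y * g⁻¹ * g = g * y := by group
  have h2 := d.map_coe_mul (MulAut.conjNormal g y) g
  rw [MulAut.conjNormal_apply, h1, d.map_mul, add_comm] at h2
  exact (add_right_cancel h2).symm

theorem restrict_nAbRep [MulDistribMulAction SigmaGroup G] [ContinuousConstSMul SigmaGroup G]
    [SigmaInvariant (N : Subgroup G)] (d : MagnusDerivation p x N.mkHom)
    (hπ : ∀ (s : SigmaGroup) (g : G), N.mkHom (s • g) = s • N.mkHom g)
    (a : Delta (N : Subgroup G)) (y : NAb N) :
    d.restrict (nAbRep p N a y) = d.rep hπ a (d.restrict y) := by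
  obtain ⟨q, s⟩ := a
  obtain ⟨g, rfl⟩ := QuotientGroup.mk_surjective q
  obtain ⟨y, rfl⟩ := NAb.mk_surjective N y
  rw [nAbRep_mk, restrict_mk, restrict_mk, rep_apply, sigmaMap_apply d hπ]
  exact d.map_conj g (sigmaHom N s y)

/-- Up to the index of `N`, the Magnus embedding has a linear retraction: the transfer crossed
homomorphism factors through the universal one. -/
theorem exists_comp_restrict (d : MagnusDerivation p x N.mkHom) :
    ∃ f : (Fin n × (G ⧸ (N : Subgroup G)) → ℤ_[p]) →ₗ[ℤ_[p]] NAb N,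
      ∀ y, f (d.restrict y) = Fintype.card (G ⧸ (N : Subgroup G)) • y := by
  let f : (Fin n × (G ⧸ (N : Subgroup G)) → ℤ_[p]) →ₗ[ℤ_[p]] NAb N :=
    Fintype.linearCombination ℤ_[p] fun a => conjRep p N a.2 (transferCrossedHom N (x a.1))
  have hgen (q i) : f (leftTranslation ℤ_[p] (Fin n) _ q (d (x i))) =
      conjRep p N q (transferCrossedHom N (x i)) := by
    rw [leftTranslation_map_gen, Fintype.linearCombination_apply_single, one_smul]
  have : T2Space (NAb N) :=
    inferInstanceAs (T2Space (TopologicalAbelianization (N : Subgroup G)))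
  have hf : ∀ g, f (d g) = transferCrossedHom N g := by
    refine d.linearMap_comp_eq (isCrossedHom_transferCrossedHom (p := p) N)
      (continuous_transferCrossedHom N) f ?_ (fun g m => ?_) (fun i => ?_)
    · exact continuous_finsetSum _ fun a _ =>
        (continuous_padic_smul_const _).comp (continuous_apply a)
    · refine LinearMap.congr_fun (f := f ∘ₗ leftTranslation ℤ_[p] (Fin n) _ (N.mkHom g))
        (g := conjRep p N (N.mkHom g) ∘ₗ f) (d.linearMap_ext fun q i => ?_) m
      rw [LinearMap.comp_apply, LinearMap.comp_apply, leftTranslation_leftTranslation, hgen, hgen,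
        _root_.map_mul]
      rfl
    · have := hgen 1 i
      rwa [_root_.map_one, _root_.map_one] at this
  refine ⟨f, fun y => ?_⟩
  obtain ⟨y, rfl⟩ := NAb.mk_surjective N y
  rw [restrict_mk, hf, transferCrossedHom_coe]

/-- The homotopy from `ℤ_p[Q]` to the Magnus module that sends a coset to the value of `d` at its
representative. It is only `ℤ_p`-linear. -/
noncomputable def homotopy (d : MagnusDerivation p x N.mkHom) :
    ((G ⧸ (N : Subgroup G)) → ℤ_[p]) →ₗ[ℤ_[p]] (Fin n × (G ⧸ (N : Subgroup G)) → ℤ_[p]) :=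
  Fintype.linearCombination ℤ_[p] fun q => d q.out

theorem homotopy_single (d : MagnusDerivation p x N.mkHom) (q : G ⧸ (N : Subgroup G)) :
    d.homotopy (Pi.single q 1) = d q.out := by
  rw [homotopy, Fintype.linearCombination_apply_single, one_smul]

/-- The homotopy property in the Magnus module. On the generator `q • d (x i)` the difference is
`d y` for the element `y` of `N` that relates `t * x i`, with `t` the representative of `q`, to the
representative of its coset. -/
theorem sub_homotopy_boundary_mem_range (d : MagnusDerivation p x N.mkHom)
    (m : Fin n × (G ⧸ (N : Subgroup G)) → ℤ_[p]) :
    m - d.homotopy (d.boundary m) ∈ LinearMap.range d.restrict := by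
  have key : (LinearMap.range d.restrict).mkQ ∘ₗ (LinearMap.id - d.homotopy ∘ₗ d.boundary) = 0 := by
    refine d.linearMap_ext fun q i => ?_
    rw [LinearMap.comp_apply, LinearMap.zero_apply, Submodule.mkQ_apply,
      Submodule.Quotient.mk_eq_zero]
    simp only [LinearMap.sub_apply, LinearMap.id_apply, LinearMap.comp_apply,
      boundary_leftTranslation_map_gen, map_sub, homotopy_single]
    set r : G ⧸ (N : Subgroup G) := q * N.mkHom (x i) with hr
    have hmem : q.out * x i * r.out⁻¹ ∈ (N : Subgroup G) := by
      rw [← QuotientGroup.eq_one_iff]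
      have : N.mkHom (x i) = (x i : G ⧸ (N : Subgroup G)) := rfl
      simp [hr, this]
    refine ⟨NAb.mk N ⟨_, hmem⟩, ?_⟩
    have h1 := d.map_coe_mul ⟨_, hmem⟩ r.out
    rw [inv_mul_cancel_right, d.map_mul] at h1
    have h2 : N.mkHom q.out = q := QuotientGroup.out_eq' q
    rw [h2] at h1
    rw [restrict_mk, sub_sub_eq_add_sub, add_comm, h1]
    abel
  have := LinearMap.congr_fun key m
  rwa [LinearMap.comp_apply, LinearMap.zero_apply, Submodule.mkQ_apply,
    Submodule.Quotient.mk_eq_zero] at this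

/-- The homotopy property in `ℤ_p[Q]`: the difference factors through the augmentation. -/
theorem boundary_homotopy (d : MagnusDerivation p x N.mkHom)
    (f : (G ⧸ (N : Subgroup G)) → ℤ_[p]) :
    d.boundary (d.homotopy f) = f - (∑ q, f q) • Pi.single 1 1 := by
  have key : d.boundary ∘ₗ d.homotopy = LinearMap.id -
      (Fintype.linearCombination ℤ_[p] fun _ => (1 : ℤ_[p])).smulRight (Pi.single 1 1) := by
    refine (Pi.basisFun ℤ_[p] _).ext fun q => ?_
    rw [Pi.basisFun_apply, LinearMap.comp_apply, homotopy_single, boundary_apply,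
      LinearMap.sub_apply, LinearMap.smulRight_apply, Fintype.linearCombination_apply_single]
    have h2 : N.mkHom q.out = q := QuotientGroup.out_eq' q
    simp [h2]
  have := LinearMap.congr_fun key f
  simpa [Fintype.linearCombination_apply] using this

theorem boundary_restrict (d : MagnusDerivation p x N.mkHom) (y : NAb N) :
    d.boundary (d.restrict y) = 0 := by
  obtain ⟨y, rfl⟩ := NAb.mk_surjective N y
  have h : N.mkHom (y : G) = 1 := (QuotientGroup.eq_one_iff _).2 y.2
  rw [restrict_mk, boundary_apply, h, sub_self]

end MagnusDerivation

/-! ### Nakayama's lemma for `ℤ_p[Q]` -/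

section Nakayama

variable {p : ℕ} [Fact p.Prime] {Q : Type*} [Group Q] [Fintype Q]

/-- Over `𝔽_p`, elements of a free module over the group ring of a finite `p`-group are linearly
independent over the group ring as soon as their images in the coinvariants are independent. A
nonzero kernel of the map they define would contain a nonzero vector fixed by `Q`, and such a
vector is a multiple of the norm element. -/
theorem linearIndependent_leftTranslation (hQ : IsPGroup p Q) {ι κ : Type*} [Fintype κ]
    (m : κ → ι × Q → ZMod p) (hm : LinearIndependent (ZMod p) fun j i => ∑ q, m j (i, q)) :
    LinearIndependent (ZMod p) fun a : κ × Q => leftTranslation (ZMod p) ι Q a.2 (m a.1) := by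
  classical
  set Ψ := Fintype.linearCombination (ZMod p)
    fun a : κ × Q => leftTranslation (ZMod p) ι Q a.2 (m a.1) with hΨ
  have hequiv (q : Q) (f : κ × Q → ZMod p) :
      Ψ (leftTranslation (ZMod p) κ Q q f) = leftTranslation (ZMod p) ι Q q (Ψ f) := by
    refine LinearMap.congr_fun (f := Ψ ∘ₗ leftTranslation (ZMod p) κ Q q)
      (g := leftTranslation (ZMod p) ι Q q ∘ₗ Ψ) ((Pi.basisFun _ _).ext fun a => ?_) f
    rw [Pi.basisFun_apply, LinearMap.comp_apply, LinearMap.comp_apply, leftTranslation_single,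
      hΨ, Fintype.linearCombination_apply_single, Fintype.linearCombination_apply_single,
      one_smul, one_smul, leftTranslation_leftTranslation]
  rw [linearIndependent_iff_injective_fintypeLinearCombination, ← LinearMap.ker_eq_bot]
  by_contra hne
  have hnt : Nontrivial (LinearMap.ker Ψ) := Submodule.nontrivial_iff_ne_bot.2 hne
  let _ : MulAction Q (LinearMap.ker Ψ) :=
    { smul := fun q f => ⟨leftTranslation (ZMod p) κ Q q f, by
        rw [LinearMap.mem_ker, hequiv, LinearMap.mem_ker.1 f.2, map_zero]⟩
      one_smul := fun f => Subtype.ext (by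
        change leftTranslation (ZMod p) κ Q 1 f = f
        rw [map_one]; rfl)
      mul_smul := fun q r f => Subtype.ext (leftTranslation_leftTranslation q r _).symm }
  have hdvd : p ∣ Nat.card (LinearMap.ker Ψ) := by
    rw [Module.natCard_eq_pow_finrank (K := ZMod p), Nat.card_zmod]
    exact dvd_pow_self _ (Module.finrank_pos).ne'
  obtain ⟨f, hf, hf0⟩ := hQ.exists_fixed_point_of_prime_dvd_card_of_fixed_point
    (LinearMap.ker Ψ) hdvd (a := 0) fun q => Subtype.ext (map_zero (leftTranslation (ZMod p) κ Q q))
  have hconst (j : κ) (q : Q) : (f : κ × Q → ZMod p) (j, q) = (f : κ × Q → ZMod p) (j, 1) := by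
    have h := congrFun (congrArg Subtype.val (hf q)) (j, q)
    change (f : κ × Q → ZMod p) (j, q⁻¹ * q) = _ at h
    rw [← h, inv_mul_cancel]
  have hsum : ∑ j, (f : κ × Q → ZMod p) (j, 1) • (fun i => ∑ q, m j (i, q)) = 0 := by
    funext i
    have h : Fintype.linearCombination (ZMod p)
        (fun a : κ × Q => leftTranslation (ZMod p) ι Q a.2 (m a.1)) f.1 (i, 1) = 0 :=
      congrFun (LinearMap.mem_ker.1 f.2) (i, 1)
    rw [Fintype.linearCombination_apply, Fintype.sum_prod_type, Finset.sum_apply] at h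
    rw [Finset.sum_apply, Pi.zero_apply, ← h]
    refine Finset.sum_congr rfl fun j _ => ?_
    rw [Finset.sum_apply, Pi.smul_apply, Finset.smul_sum, ← Equiv.sum_comp (Equiv.inv Q)]
    refine Finset.sum_congr rfl fun q _ => ?_
    rw [Pi.smul_apply, leftTranslation_apply, hconst j q, mul_one]
    rfl
  have hzero := Fintype.linearIndependent_iff.1 hm _ hsum
  refine hf0 (Subtype.ext (funext fun a => ?_))
  rw [hconst a.1 a.2, hzero]
  rfl

theorem isLocalHom_toZMod : IsLocalHom (PadicInt.toZMod : ℤ_[p] →+* ZMod p) :=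
  IsLocalHom.of_surjective _ (ZMod.ringHom_surjective _)

/-- The coinvariants modulo `p` of the free `ℤ_p[Q]`-module on `ι`. -/
noncomputable def coinvariantsModP {ι : Type*} : (ι × Q → ℤ_[p]) →+ (ι → ZMod p) where
  toFun f i := ∑ q, PadicInt.toZMod (f (i, q))
  map_zero' := by ext; simp
  map_add' f g := by ext; simp [Finset.sum_add_distrib]

theorem coinvariantsModP_apply {ι : Type*} (f : ι × Q → ℤ_[p]) (i : ι) :
    coinvariantsModP f i = ∑ q, PadicInt.toZMod (f (i, q)) := rfl

theorem coinvariantsModP_smul {ι : Type*} (c : ℤ_[p]) (f : ι × Q → ℤ_[p]) :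
    coinvariantsModP (c • f) = PadicInt.toZMod c • coinvariantsModP f := by
  ext
  simp [coinvariantsModP_apply, Finset.mul_sum]

theorem coinvariantsModP_leftTranslation {ι : Type*} (q : Q) (f : ι × Q → ℤ_[p]) :
    coinvariantsModP (leftTranslation ℤ_[p] ι Q q f) = coinvariantsModP f := by
  ext i
  exact Equiv.sum_comp (Equiv.mulLeft q⁻¹) fun r => PadicInt.toZMod (f (i, r))

/-- Elements of a free `ℤ_p[Q]`-module of the right number form a basis if they do so modulo `p`
in the coinvariants: the determinant of the matrix of their translates is a unit modulo `p`. -/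
theorem exists_basis_leftTranslation (hQ : IsPGroup p Q) {n : ℕ} (m : Fin n → Fin n × Q → ℤ_[p])
    (hm : LinearIndependent (ZMod p) fun j => coinvariantsModP (m j)) :
    ∃ b : Module.Basis (Fin n × Q) ℤ_[p] (Fin n × Q → ℤ_[p]),
      ∀ a, b a = leftTranslation ℤ_[p] (Fin n) Q a.2 (m a.1) := by
  classical
  set v : Fin n × Q → (Fin n × Q → ℤ_[p]) :=
    fun a => leftTranslation ℤ_[p] (Fin n) Q a.2 (m a.1) with hv
  set B : Matrix (Fin n × Q) (Fin n × Q) ℤ_[p] := Matrix.of fun a b => v b a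
  have hB : IsUnit (B.map PadicInt.toZMod) := by
    rw [← Matrix.linearIndependent_cols_iff_isUnit]
    exact linearIndependent_leftTranslation hQ (fun j a => PadicInt.toZMod (m j a)) hm
  have hdet : IsUnit B.det := by
    have := isLocalHom_toZMod (p := p)
    refine isUnit_of_map_unit (PadicInt.toZMod : ℤ_[p] →+* ZMod p) _ ?_
    rw [RingHom.map_det]
    exact (Matrix.isUnit_iff_isUnit_det _).1 hB
  have hbasis := (Module.Basis.is_basis_iff_det (Pi.basisFun ℤ_[p] (Fin n × Q)) (v := v)).2
    (by
      rw [Module.Basis.det_apply]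
      exact hdet)
  exact ⟨Module.Basis.mk hbasis.1 hbasis.2.ge, fun a => Module.Basis.mk_apply _ _ _⟩

end Nakayama

/-! ### The Frattini quotient -/

theorem PadicInt.continuous_toZMod {p : ℕ} [Fact p.Prime] :
    Continuous (PadicInt.toZMod : ℤ_[p] →+* ZMod p) := by
  refine continuous_of_continuousAt_zero (PadicInt.toZMod : ℤ_[p] →+* ZMod p) ?_
  refine Filter.Tendsto.congr' ?_ (tendsto_const_nhds (x := _) (f := 𝓝 (0 : ℤ_[p])))
  filter_upwards [Metric.ball_mem_nhds (0 : ℤ_[p]) one_pos] with z hz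
  rw [map_zero]
  have : z ∈ RingHom.ker (PadicInt.toZMod : ℤ_[p] →+* ZMod p) := by
    rw [PadicInt.ker_toZMod, IsLocalRing.mem_maximalIdeal, PadicInt.mem_nonunits]
    simpa using hz
  exact this.symm

/-- An involution in characteristic different from `2` has a basis of eigenvectors. -/
theorem Module.End.exists_basis_of_mul_self_eq_one {k V : Type*} [Field k] (h2 : (2 : k) ≠ 0)
    [AddCommGroup V] [Module k V] [FiniteDimensional k V] (f : Module.End k V) (hf : f * f = 1) :
    ∃ b : Module.Basis (Fin (Module.finrank k (f.eigenspace (((1 : ℤˣ) : ℤ) : k))) ⊕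
        Fin (Module.finrank k (f.eigenspace (((-1 : ℤˣ) : ℤ) : k)))) k V,
      (∀ i, f (b (Sum.inl i)) = b (Sum.inl i)) ∧ ∀ i, f (b (Sum.inr i)) = -b (Sum.inr i) := by
  have hff (v : V) : f (f v) = v := LinearMap.congr_fun hf v
  have hcompl : IsCompl (f.eigenspace (((1 : ℤˣ) : ℤ) : k))
      (f.eigenspace (((-1 : ℤˣ) : ℤ) : k)) := by
    refine ⟨?_, ?_⟩
    · rw [Submodule.disjoint_def]
      intro v h1 h2'
      rw [Module.End.mem_eigenspace_iff] at h1 h2'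
      simp only [Units.val_one, Int.cast_one, one_smul, Units.val_neg, Int.cast_neg,
        neg_smul] at h1 h2'
      have h3 : (2 : k) • v = 0 := by
        rw [two_smul]
        nth_rw 1 [← h1, h2']
        simp
      exact (smul_eq_zero.1 h3).resolve_left h2
    · rw [codisjoint_iff, Submodule.eq_top_iff']
      intro v
      refine Submodule.mem_sup.2 ⟨(2 : k)⁻¹ • (v + f v), ?_, (2 : k)⁻¹ • (v - f v), ?_, ?_⟩
      · rw [Module.End.mem_eigenspace_iff]
        simp [hff, add_comm]
      · rw [Module.End.mem_eigenspace_iff]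
        simp [hff, ← smul_neg]
      · rw [← smul_add, add_add_sub_cancel, ← two_smul k v, smul_smul, inv_mul_cancel₀ h2,
          one_smul]
  refine ⟨((Module.finBasis k _).prod (Module.finBasis k _)).map
    (Submodule.prodEquivOfIsCompl _ _ hcompl), fun i => ?_, fun i => ?_⟩
  · have := Module.End.mem_eigenspace_iff.1
      (Module.finBasis k (f.eigenspace (((1 : ℤˣ) : ℤ) : k)) i).2
    simpa using this
  · have := Module.End.mem_eigenspace_iff.1
      (Module.finBasis k (f.eigenspace (((-1 : ℤˣ) : ℤ) : k)) i).2
    simpa using this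

namespace MagnusDerivation

variable {p : ℕ} [Fact p.Prime] {G Q : Type*} [Group G] [TopologicalSpace G]
    [IsTopologicalGroup G] [Group Q] [TopologicalSpace Q] [DiscreteTopology Q] [Fintype Q]
    [DecidableEq Q] {n : ℕ} {x : Fin n → G} {π : G →ₜ* Q}

/-- The universal crossed homomorphism identifies the Frattini quotient of `G` with the
coinvariants modulo `p` of the Magnus module. -/
theorem exists_frattini_linearEquiv (d : MagnusDerivation p x π) :
    ∃ e : Additive (G ⧸ proPFrattini p G) ≃ₗ[ZMod p] (Fin n → ZMod p),
      ∀ g : G, e (Additive.ofMul (g : G ⧸ proPFrattini p G)) = coinvariantsModP (d g) := by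
  let f : G →* Multiplicative (Fin n → ZMod p) :=
    MonoidHom.mk' (fun g => Multiplicative.ofAdd (coinvariantsModP (d g))) fun g h => by
      rw [d.map_mul, _root_.map_add, coinvariantsModP_leftTranslation]
      rfl
  have hcoinv : Continuous (coinvariantsModP : (Fin n × Q → ℤ_[p]) → (Fin n → ZMod p)) :=
    continuous_pi fun i => continuous_finsetSum _ fun q _ =>
      PadicInt.continuous_toZMod.comp (continuous_apply _)
  have hf : Continuous f := hcoinv.comp d.continuous_toFun
  have hle : proPFrattini p G ≤ f.ker := by
    refine Subgroup.topologicalClosure_minimal _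
      (sup_le ?_ (Abelianization.commutator_subset_ker f)) (isClosed_singleton.preimage hf)
    rw [Subgroup.closure_le]
    rintro _ ⟨g, rfl⟩
    change f (g ^ p) = 1
    rw [map_pow]
    change p • coinvariantsModP (d g) = 0
    ext i
    simp
  let F : Additive (G ⧸ proPFrattini p G) →ₗ[ZMod p] (Fin n → ZMod p) :=
    AddMonoidHom.toZModLinearMap p (MonoidHom.toAdditive (QuotientGroup.lift _ f hle))
  have hF (g : G) : F (Additive.ofMul (g : G ⧸ proPFrattini p G)) = coinvariantsModP (d g) := rfl
  let y : Fin n → Additive (G ⧸ proPFrattini p G) :=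
    fun i => Additive.ofMul (x i : G ⧸ proPFrattini p G)
  have hFy (i : Fin n) : F (y i) = Pi.single i 1 := by
    rw [hF, d.map_gen]
    funext j
    rw [coinvariantsModP_apply]
    rcases eq_or_ne j i with rfl | hj
    · simp [Pi.single_apply, Prod.ext_iff, apply_ite]
    · simp [Prod.ext_iff, hj]
  have hsurj : Function.Surjective F := by
    rw [← LinearMap.range_eq_top, ← top_le_iff, ← (Pi.basisFun (ZMod p) (Fin n)).span_eq,
      Submodule.span_le]
    rintro _ ⟨i, rfl⟩
    exact ⟨y i, by rw [hFy, Pi.basisFun_apply]⟩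
  -- the span of the classes of the `x i` is finite, so its preimage in `G` is closed
  have hspan : Submodule.span (ZMod p) (Set.range y) = ⊤ := by
    set S := Submodule.span (ZMod p) (Set.range y)
    have : IsClosed (proPFrattini p G : Set G) := Subgroup.isClosed_topologicalClosure _
    have : Module.Finite (ZMod p) S := Module.Finite.span_of_finite _ (Set.finite_range y)
    have hfin : Finite S := Module.finite_of_finite (ZMod p)
    let K : Subgroup G := (AddSubgroup.toSubgroup' S.toAddSubgroup).comap
      (QuotientGroup.mk' (proPFrattini p G))
    have hK : IsClosed (K : Set G) :=
      (Set.Finite.isClosed (s := Additive.ofMul ⁻¹' (S : Set (Additive (G ⧸ proPFrattini p G))))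
        hfin).preimage QuotientGroup.continuous_mk
    have htop : (⊤ : Subgroup G) ≤ K := by
      rw [← d.topologicalClosure_eq_top]
      refine Subgroup.topologicalClosure_minimal _ ((Subgroup.closure_le _).2 ?_) hK
      rintro _ ⟨i, rfl⟩
      exact Submodule.subset_span (s := Set.range y) ⟨i, rfl⟩
    rw [Submodule.eq_top_iff']
    intro v
    obtain ⟨g, hg⟩ := QuotientGroup.mk_surjective v.toMul
    have : g ∈ K := htop (Subgroup.mem_top g)
    exact (congrArg (· ∈ S) (congrArg Additive.ofMul hg)).mp this
  have : Module.Finite (ZMod p) (Additive (G ⧸ proPFrattini p G)) :=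
    ⟨⟨(Set.finite_range y).toFinset, by simpa using hspan⟩⟩
  have hle' : Module.finrank (ZMod p) (Additive (G ⧸ proPFrattini p G)) ≤ n := by
    have := finrank_range_le_card (R := ZMod p) y
    rwa [Set.finrank, hspan, finrank_top, Fintype.card_fin] at this
  have hge := LinearMap.finrank_le_finrank_of_surjective hsurj
  rw [Module.finrank_fin_fun] at hge
  have hinj : Function.Injective F :=
    (LinearMap.injective_iff_surjective_of_finrank_eq_finrank
      (by rw [Module.finrank_fin_fun]; exact le_antisymm hle' hge)).2 hsurj
  exact ⟨LinearEquiv.ofBijective F ⟨hinj, hsurj⟩, hF⟩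

/-- If `σ` acts on the free pro-`p` group, the Magnus module has a basis over the group ring of
`Q` that consists of even and odd vectors, as many as in the Frattini quotient of `G`: eigenvectors
in the Frattini quotient lift to eigenvectors in the Magnus module, because `2` is invertible. -/
theorem exists_eigenbasis [MulDistribMulAction SigmaGroup G] [ContinuousConstSMul SigmaGroup G]
    [MulDistribMulAction SigmaGroup Q] (hp : p ≠ 2) (hQ : IsPGroup p Q)
    (d : MagnusDerivation p x π) (hπ : ∀ (s : SigmaGroup) (g : G), π (s • g) = s • π g) :
    ∃ (m : Fin (dSign p G 1) ⊕ Fin (dSign p G (-1)) → Fin n × Q → ℤ_[p])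
      (b : Module.Basis ((Fin (dSign p G 1) ⊕ Fin (dSign p G (-1))) × Q) ℤ_[p]
        (Fin n × Q → ℤ_[p])),
      (∀ a, b a = leftTranslation ℤ_[p] (Fin n) Q a.2 (m a.1)) ∧
      (∀ i, d.sigmaMap sigma (m (Sum.inl i)) = m (Sum.inl i)) ∧
      ∀ i, d.sigmaMap sigma (m (Sum.inr i)) = -m (Sum.inr i) := by
  obtain ⟨e, he⟩ := d.exists_frattini_linearEquiv
  have : Module.Finite (ZMod p) (Additive (G ⧸ proPFrattini p G)) := Module.Finite.equiv e.symm
  have h2 : (2 : ZMod p) ≠ 0 := by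
    intro h
    have h' : ((2 : ℕ) : ZMod p) = 0 := by exact_mod_cast h
    rw [ZMod.natCast_eq_zero_iff] at h'
    exact hp ((Nat.prime_dvd_prime_iff_eq Fact.out Nat.prime_two).1 h')
  have hσσ (g : G) : sigma • sigma • g = g := by
    rw [smul_smul, show sigma * sigma = 1 from rfl, one_smul]
  have hFσ (g : G) : frattiniSigma p G (Additive.ofMul (g : G ⧸ proPFrattini p G)) =
      Additive.ofMul ((sigma • g : G) : G ⧸ proPFrattini p G) := rfl
  have hsq : frattiniSigma p G * frattiniSigma p G = 1 := by
    refine LinearMap.ext fun v => ?_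
    obtain ⟨g, hg⟩ := QuotientGroup.mk_surjective v.toMul
    obtain rfl : Additive.ofMul (g : G ⧸ proPFrattini p G) = v := congrArg Additive.ofMul hg
    rw [Module.End.mul_apply, hFσ, hFσ, hσσ]
    rfl
  obtain ⟨c, hc1, hc2⟩ : ∃ c : Module.Basis (Fin (dSign p G 1) ⊕ Fin (dSign p G (-1))) (ZMod p)
      (Additive (G ⧸ proPFrattini p G)),
      (∀ i, frattiniSigma p G (c (Sum.inl i)) = c (Sum.inl i)) ∧
        ∀ i, frattiniSigma p G (c (Sum.inr i)) = -c (Sum.inr i) :=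
    (frattiniSigma p G).exists_basis_of_mul_self_eq_one h2 hsq
  obtain ⟨g, hg⟩ : ∃ g : Fin (dSign p G 1) ⊕ Fin (dSign p G (-1)) → G,
      ∀ j, Additive.ofMul (g j : G ⧸ proPFrattini p G) = c j := by
    refine ⟨fun j => (c j).toMul.out, fun j => ?_⟩
    exact congrArg Additive.ofMul (QuotientGroup.out_eq' (c j).toMul)
  obtain ⟨u, hu⟩ : IsUnit (2 : ℤ_[p]) := by
    have := isLocalHom_toZMod (p := p)
    refine isUnit_of_map_unit (PadicInt.toZMod : ℤ_[p] →+* ZMod p) _ ?_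
    rw [map_ofNat]
    exact h2.isUnit
  have hσd (g : G) : d.sigmaMap sigma (d.sigmaMap sigma (d g)) = d g := by
    rw [sigmaMap_apply d hπ, sigmaMap_apply d hπ, hσσ]
  have hu2 : PadicInt.toZMod (↑u⁻¹ : ℤ_[p]) * 2 = 1 := by
    rw [← map_ofNat (PadicInt.toZMod : ℤ_[p] →+* ZMod p) 2, ← _root_.map_mul, ← hu, Units.inv_mul,
      _root_.map_one]
  -- lift the eigenvectors by means of `d` and project to the eigenspaces of `σ` by `(1 ± σ) / 2`
  let m : Fin (dSign p G 1) ⊕ Fin (dSign p G (-1)) → Fin n × Q → ℤ_[p] :=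
    Sum.elim (fun i => (↑u⁻¹ : ℤ_[p]) • (d (g (Sum.inl i)) + d.sigmaMap sigma (d (g (Sum.inl i)))))
      fun i => (↑u⁻¹ : ℤ_[p]) • (d (g (Sum.inr i)) - d.sigmaMap sigma (d (g (Sum.inr i))))
  have hm (j) : coinvariantsModP (m j) = e (c j) := by
    rcases j with i | i
    · change coinvariantsModP ((↑u⁻¹ : ℤ_[p]) • _) = _
      rw [coinvariantsModP_smul, _root_.map_add, sigmaMap_apply d hπ, ← he, ← he, ← hFσ, hg, hc1,
        ← two_smul (ZMod p) (e _), smul_smul, hu2, one_smul]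
    · change coinvariantsModP ((↑u⁻¹ : ℤ_[p]) • _) = _
      rw [coinvariantsModP_smul, _root_.map_sub, sigmaMap_apply d hπ, ← he, ← he, ← hFσ, hg, hc2,
        _root_.map_neg, sub_neg_eq_add, ← two_smul (ZMod p) (e _), smul_smul, hu2, one_smul]
  let c' := c.map e
  let ε : Fin (dSign p G 1) ⊕ Fin (dSign p G (-1)) ≃ Fin n :=
    c'.indexEquiv (Pi.basisFun (ZMod p) (Fin n))
  obtain ⟨b, hb⟩ := exists_basis_leftTranslation hQ (m ∘ ε.symm) (by
    have : (fun j => coinvariantsModP ((m ∘ ε.symm) j)) = c' ∘ ε.symm :=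
      funext fun j => hm _
    rw [this]
    exact c'.linearIndependent.comp _ ε.symm.injective)
  refine ⟨m, b.reindex (ε.symm.prodCongr (Equiv.refl Q)), fun a => ?_, fun i => ?_, fun i => ?_⟩
  · rw [Module.Basis.reindex_apply, hb]
    simp
  · change d.sigmaMap sigma ((↑u⁻¹ : ℤ_[p]) • _) = (↑u⁻¹ : ℤ_[p]) • _
    rw [map_smul, _root_.map_add, hσd, add_comm]
  · change d.sigmaMap sigma ((↑u⁻¹ : ℤ_[p]) • _) = -((↑u⁻¹ : ℤ_[p]) • _)
    rw [map_smul, _root_.map_sub, hσd, ← smul_neg, neg_sub]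

end MagnusDerivation

/-! ### Extension of scalars and splittings -/

/-- The extension of scalars of a representation from `ℤ_p` to `ℚ_p`. -/
noncomputable def Representation.rational {p : ℕ} [Fact p.Prime] {D W : Type*} [Monoid D]
    [AddCommGroup W] [Module ℤ_[p] W] (ρ : Representation ℤ_[p] D W) :
    Representation ℚ_[p] D (ℚ_[p] ⊗[ℤ_[p]] W) :=
  (Module.End.baseChangeHom ℤ_[p] ℚ_[p] W : _ →* _).comp ρ

theorem Representation.rational_tmul {p : ℕ} [Fact p.Prime] {D W : Type*} [Monoid D]
    [AddCommGroup W] [Module ℤ_[p] W] (ρ : Representation ℤ_[p] D W) (d : D) (c : ℚ_[p]) (w : W) :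
    ρ.rational d (c ⊗ₜ w) = c ⊗ₜ ρ d w := rfl

/-- The extension of scalars of an equivariant map, as a linear map over the group ring. -/
noncomputable def LinearMap.rational {p : ℕ} [Fact p.Prime] {D W W' : Type*} [Monoid D]
    [AddCommGroup W] [Module ℤ_[p] W] [AddCommGroup W'] [Module ℤ_[p] W']
    {ρ : Representation ℤ_[p] D W} {ρ' : Representation ℤ_[p] D W'} (f : W →ₗ[ℤ_[p]] W')
    (hf : ∀ d w, f (ρ d w) = ρ' d (f w)) :
    ρ.rational.asModule →ₗ[MonoidAlgebra ℚ_[p] D] ρ'.rational.asModule :=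
  Representation.IntertwiningMap.equivLinearMapAsModule ρ.rational ρ'.rational
    { toLinearMap := f.baseChange ℚ_[p]
      isIntertwining' := fun d => by
        ext w
        simp [Representation.rational_tmul, hf] }

/-- An exact sequence `0 → A → M → P → T → 0` of semisimple modules gives `A ⊕ P ≅ T ⊕ M`. -/
theorem nonempty_prod_linearEquiv_of_exact {R A M P T : Type*} [Ring R] [IsSemisimpleRing R]
    [AddCommGroup A] [Module R A] [AddCommGroup M] [Module R M] [AddCommGroup P] [Module R P]
    [AddCommGroup T] [Module R T] {i : A →ₗ[R] M} {f : M →ₗ[R] P} {g : P →ₗ[R] T}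
    (hi : Function.Injective i) (hif : Function.Exact i f) (hfg : Function.Exact f g)
    (hg : Function.Surjective g) : Nonempty ((A × P) ≃ₗ[R] (T × M)) := by
  obtain ⟨l, hl⟩ := IsSemisimpleModule.extension_property i hi LinearMap.id
  obtain ⟨s, hs⟩ := IsSemisimpleModule.lifting_property g hg LinearMap.id
  have h1 : Function.Exact i f.rangeRestrict := fun m => by
    rw [← hif m]
    exact Subtype.ext_iff
  have h2 : Function.Exact (LinearMap.range f).subtype g := fun y => by
    rw [hfg y]
    simp
  let e1 := (h1.splitInjectiveEquiv f.surjective_rangeRestrict ⟨l, hl⟩).1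
  let e2 := (h2.splitSurjectiveEquiv (Submodule.subtype_injective _) ⟨s, hs⟩).1
  exact ⟨(LinearEquiv.prodCongr (LinearEquiv.refl R A) e2).trans <|
    (LinearEquiv.prodAssoc R A (LinearMap.range f) T).symm.trans <|
    (LinearEquiv.prodCongr e1.symm (LinearEquiv.refl R T)).trans (LinearEquiv.prodComm R M T)⟩

/-! ### Even and odd vectors -/

section VSign

variable {p : ℕ} [Fact p.Prime] {G : Type*} [Group G] [MulDistribMulAction SigmaGroup G]
  (N : Subgroup G) [N.Normal] [SigmaInvariant N]

/-- The generator `σ + ε` of `V_ε`. -/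
noncomputable def VSign.gen (ε : ℤˣ) : VSign p N ε :=
  ⟨MonoidAlgebra.of ℚ_[p] (Delta N) (deltaSigma N) + ((ε : ℤ) : MonoidAlgebra ℚ_[p] (Delta N)),
    Submodule.mem_span_singleton_self _⟩

theorem VSign.of_sigma_smul_gen (ε : ℤˣ) :
    MonoidAlgebra.of ℚ_[p] (Delta N) (deltaSigma N) • VSign.gen (p := p) N ε =
      (ε : ℤ) • VSign.gen N ε := by
  have h : MonoidAlgebra.of ℚ_[p] (Delta N) (deltaSigma N) *
      MonoidAlgebra.of ℚ_[p] (Delta N) (deltaSigma N) = 1 := by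
    rw [← map_mul, deltaSigma, ← map_mul, show sigma * sigma = 1 from rfl, map_one, map_one]
  refine Subtype.ext ?_
  change MonoidAlgebra.of ℚ_[p] (Delta N) (deltaSigma N) *
    (MonoidAlgebra.of ℚ_[p] (Delta N) (deltaSigma N) + ((ε : ℤ) : MonoidAlgebra ℚ_[p] (Delta N))) =
    (ε : ℤ) • (MonoidAlgebra.of ℚ_[p] (Delta N) (deltaSigma N) +
      ((ε : ℤ) : MonoidAlgebra ℚ_[p] (Delta N)))
  rw [mul_add, h]
  rcases Int.units_eq_one_or ε with rfl | rfl <;> simp [add_comm]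

/-- `V_ε` is spanned over `ℚ_p` by the multiples of `σ + ε` by elements of `G / N`. -/
theorem VSign.exists_eq_sum [Fintype (G ⧸ N)] (ε : ℤˣ) (v : VSign p N ε) :
    ∃ c : G ⧸ N → ℚ_[p], v = ∑ q, (MonoidAlgebra.single (SemidirectProduct.inl q : Delta N) (c q) :
      MonoidAlgebra ℚ_[p] (Delta N)) • VSign.gen N ε := by
  classical
  obtain ⟨v, hv⟩ := v
  obtain ⟨r, rfl⟩ := Submodule.mem_span_singleton.1 hv
  change ∃ c : G ⧸ N → ℚ_[p], r • VSign.gen N ε = _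
  clear hv
  induction r using MonoidAlgebra.induction_linear with
  | zero => exact ⟨0, by simp⟩
  | add r s hr hs =>
    obtain ⟨c, hc⟩ := hr
    obtain ⟨c', hc'⟩ := hs
    refine ⟨c + c', ?_⟩
    rw [add_smul, hc, hc', ← Finset.sum_add_distrib]
    refine Finset.sum_congr rfl fun q _ => ?_
    rw [Pi.add_apply, MonoidAlgebra.single_add, add_smul]
  | single d t =>
    obtain ⟨u, hu⟩ : ∃ u : ℤ, MonoidAlgebra.single (SemidirectProduct.inr d.right : Delta N)
        (1 : ℚ_[p]) • VSign.gen (p := p) N ε = u • VSign.gen N ε := by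
      rcases (show ∀ s : SigmaGroup, s = 1 ∨ s = sigma by decide) d.right with h | h
      · refine ⟨1, ?_⟩
        rw [h, map_one, ← MonoidAlgebra.one_def, one_smul, one_smul]
      · refine ⟨ε, ?_⟩
        rw [h]
        exact VSign.of_sigma_smul_gen N ε
    refine ⟨Pi.single d.left (t * u), ?_⟩
    rw [Finset.sum_eq_single d.left (fun q _ hq => by rw [Pi.single_eq_of_ne hq]; simp)
      (fun h => absurd (Finset.mem_univ _) h), Pi.single_eq_same]
    have h1 : (MonoidAlgebra.single d t : MonoidAlgebra ℚ_[p] (Delta N)) =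
        MonoidAlgebra.single (SemidirectProduct.inl d.left : Delta N) t *
          MonoidAlgebra.single (SemidirectProduct.inr d.right) 1 := by
      rw [MonoidAlgebra.single_mul_single, mul_one, SemidirectProduct.inl_left_mul_inr_right]
    rw [h1, mul_smul, hu, smul_comm, ← Int.cast_smul_eq_zsmul (MonoidAlgebra ℚ_[p] (Delta N)),
      smul_smul]
    congr 1
    rw [← Int.smul_one_eq_cast, smul_one_mul, MonoidAlgebra.smul_single, zsmul_eq_mul, mul_comm]

variable {N} {W : Type*} [AddCommGroup W] [Module ℚ_[p] W]

/-- For a vector `w` on which `σ` acts by `ε`, the homomorphism from `V_ε` that maps `σ + ε` to `w`.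
It is defined for all `w`, as the restriction to `V_ε` of a homomorphism on the whole group ring. -/
noncomputable def VSign.lift (ρ : Representation ℚ_[p] (Delta N) W) (ε : ℤˣ) (w : W) :
    VSign p N ε →ₗ[MonoidAlgebra ℚ_[p] (Delta N)] ρ.asModule :=
  -- `σ + ε` acts on a vector of sign `ε` as multiplication by `2 ε`
  (LinearMap.toSpanSingleton _ ρ.asModule
    (ρ.asModuleEquiv.symm ((2⁻¹ : ℚ_[p]) • (ε : ℤ) • w))).comp (Submodule.subtype _)

theorem VSign.lift_gen (ρ : Representation ℚ_[p] (Delta N) W) {ε : ℤˣ} {w : W}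
    (hw : ρ (deltaSigma N) w = (ε : ℤ) • w) :
    VSign.lift ρ ε w (VSign.gen N ε) = ρ.asModuleEquiv.symm w := by
  have h2 : (2 : ℚ_[p]) ≠ 0 := two_ne_zero
  change (MonoidAlgebra.of ℚ_[p] (Delta N) (deltaSigma N) +
    ((ε : ℤ) : MonoidAlgebra ℚ_[p] (Delta N))) • ρ.asModuleEquiv.symm _ = _
  rw [add_smul, ← Representation.asModuleEquiv_symm_map_rho, Int.cast_smul_eq_zsmul, ← map_zsmul,
    ← map_add]
  congr 1
  rw [map_smul, map_zsmul, hw, smul_comm (ε : ℤ) (2⁻¹ : ℚ_[p]), ← smul_add, smul_smul]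
  rcases Int.units_eq_one_or ε with rfl | rfl <;> simp [← two_smul ℚ_[p] w, smul_smul, h2]

/-- A representation of `Δ` with a basis consisting of the translates under `G / N` of vectors of
given signs is the direct sum of the corresponding `V_ε`. -/
theorem VSign.nonempty_pi_linearEquiv [Fintype (G ⧸ N)] (ρ : Representation ℚ_[p] (Delta N) W)
    {J : Type*} [Fintype J] (ε : J → ℤˣ) (m : J → W)
    (hm : ∀ j, ρ (deltaSigma N) (m j) = (ε j : ℤ) • m j)
    (b : Module.Basis (J × (G ⧸ N)) ℚ_[p] W)
    (hb : ∀ a, b a = ρ (SemidirectProduct.inl a.2) (m a.1)) :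
    Nonempty (((j : J) → VSign p N (ε j)) ≃ₗ[MonoidAlgebra ℚ_[p] (Delta N)] ρ.asModule) := by
  classical
  let Ψ : ((j : J) → VSign p N (ε j)) →ₗ[MonoidAlgebra ℚ_[p] (Delta N)] ρ.asModule :=
    ∑ j, (VSign.lift ρ (ε j) (m j)).comp (LinearMap.proj j)
  let S (c : J × (G ⧸ N) → ℚ_[p]) (j : J) : VSign p N (ε j) :=
    ∑ q, (MonoidAlgebra.single (SemidirectProduct.inl q : Delta N) (c (j, q)) :
      MonoidAlgebra ℚ_[p] (Delta N)) • VSign.gen N (ε j)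
  have hS : Function.Surjective S := fun v => by
    choose c hc using fun j => VSign.exists_eq_sum N (ε j) (v j)
    exact ⟨fun a => c a.1 a.2, funext fun j => (hc j).symm⟩
  have hΨS (c) : Ψ (S c) = ρ.asModuleEquiv.symm (b.equivFun.symm c) := by
    rw [Module.Basis.equivFun_symm_apply, Fintype.sum_prod_type, map_sum, LinearMap.sum_apply]
    refine Finset.sum_congr rfl fun j _ => ?_
    rw [LinearMap.comp_apply, LinearMap.proj_apply, map_sum, map_sum]
    refine Finset.sum_congr rfl fun q _ => ?_
    rw [map_smul, VSign.lift_gen ρ (hm j), Representation.single_smul, hb]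
    rfl
  have hbij : Function.Bijective fun c => ρ.asModuleEquiv.symm (b.equivFun.symm c) :=
    ρ.asModuleEquiv.symm.bijective.comp b.equivFun.symm.bijective
  refine ⟨LinearEquiv.ofBijective Ψ ⟨fun v v' h => ?_, fun w => ?_⟩⟩
  · obtain ⟨c, rfl⟩ := hS v
    obtain ⟨c', rfl⟩ := hS v'
    rw [hΨS, hΨS] at h
    rw [hbij.1 h]
  · obtain ⟨c, rfl⟩ := hbij.2 w
    exact ⟨S c, hΨS c⟩

end VSign

/-! ### The relation module over `ℚ_p` -/

/-- The augmentation `ℚ_p[Q] → ℚ_p`. -/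
noncomputable def rationalAugmentation (p : ℕ) [Fact p.Prime] (Q : Type*) [Fintype Q] :
    ℚ_[p] ⊗[ℤ_[p]] (Q → ℤ_[p]) →ₗ[ℚ_[p]] ℚ_[p] :=
  (Fintype.linearCombination ℤ_[p] fun _ => (1 : ℚ_[p])).liftBaseChange ℚ_[p]

theorem rationalAugmentation_tmul (p : ℕ) [Fact p.Prime] {Q : Type*} [Fintype Q] (c : ℚ_[p])
    (f : Q → ℤ_[p]) :
    rationalAugmentation p Q (c ⊗ₜ f) = c * ((∑ q, f q : ℤ_[p]) : ℚ_[p]) := by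
  rw [rationalAugmentation, LinearMap.liftBaseChange_tmul, Fintype.linearCombination_apply,
    smul_eq_mul]
  congr 1
  simp [Algebra.smul_def]

theorem rationalAugmentation_permRep {p : ℕ} [Fact p.Prime] {Q : Type*} [Group Q] [Fintype Q]
    [MulDistribMulAction SigmaGroup Q]
    (a : Q ⋊[MulDistribMulAction.toMulAut SigmaGroup Q] SigmaGroup)
    (f : ℚ_[p] ⊗[ℤ_[p]] (Q → ℤ_[p])) :
    rationalAugmentation p Q ((permRep ℤ_[p] Q).rational a f) =
      rationalAugmentation p Q f := by
  induction f using TensorProduct.induction_on with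
  | zero => simp
  | tmul c f =>
    rw [Representation.rational_tmul, rationalAugmentation_tmul,
      rationalAugmentation_tmul]
    congr 2
    exact Equiv.sum_comp ((Equiv.mulLeft a.left⁻¹).trans (MulAction.toPerm a.right⁻¹)) f
  | add a b ha hb => rw [map_add, map_add, map_add, ha, hb]

namespace MagnusDerivation

variable {p : ℕ} [Fact p.Prime] {G : Type*} [Group G] [TopologicalSpace G] [IsTopologicalGroup G]
  [CompactSpace G] [TotallyDisconnectedSpace G] [IsProP p G] {N : OpenNormalSubgroup G}
  [Fintype (G ⧸ (N : Subgroup G))] [DecidableEq (G ⧸ (N : Subgroup G))]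
  {n : ℕ} {x : Fin n → G}

theorem injective_baseChange_restrict (d : MagnusDerivation p x N.mkHom) :
    Function.Injective (d.restrict.baseChange ℚ_[p]) := by
  obtain ⟨f, hf⟩ := d.exists_comp_restrict
  have h : f.baseChange ℚ_[p] ∘ₗ d.restrict.baseChange ℚ_[p] =
      (Fintype.card (G ⧸ (N : Subgroup G)) : ℚ_[p]) • LinearMap.id := by
    ext y
    simp [hf, TensorProduct.smul_tmul', ← Nat.cast_smul_eq_nsmul ℤ_[p],
      TensorProduct.tmul_smul, Algebra.smul_def]
  intro y z hyz
  have hy := LinearMap.congr_fun h y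
  have hz := LinearMap.congr_fun h z
  rw [LinearMap.comp_apply, hyz, ← LinearMap.comp_apply, hz] at hy
  rw [LinearMap.smul_apply, LinearMap.smul_apply] at hy
  exact (smul_right_injective _ (r := (Fintype.card (G ⧸ (N : Subgroup G)) : ℚ_[p]))
    (Nat.cast_ne_zero.2 Fintype.card_ne_zero) hy).symm

theorem exact_baseChange_restrict_boundary (d : MagnusDerivation p x N.mkHom) :
    Function.Exact (d.restrict.baseChange ℚ_[p]) (d.boundary.baseChange ℚ_[p]) := by
  intro m
  constructor
  · intro hm
    have key (m : ℚ_[p] ⊗[ℤ_[p]] (Fin n × (G ⧸ (N : Subgroup G)) → ℤ_[p])) :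
        m - d.homotopy.baseChange ℚ_[p] (d.boundary.baseChange ℚ_[p] m) ∈
          LinearMap.range (d.restrict.baseChange ℚ_[p]) := by
      induction m using TensorProduct.induction_on with
      | zero => simp
      | tmul c m =>
        obtain ⟨y, hy⟩ := d.sub_homotopy_boundary_mem_range m
        refine ⟨c ⊗ₜ y, ?_⟩
        rw [LinearMap.baseChange_tmul, hy, TensorProduct.tmul_sub, LinearMap.baseChange_tmul,
          LinearMap.baseChange_tmul]
      | add a b ha hb =>
        rw [map_add, map_add, add_sub_add_comm]
        exact add_mem ha hb
    have := key m
    rw [hm, map_zero, sub_zero] at this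
    exact this
  · rintro ⟨y, rfl⟩
    rw [← LinearMap.comp_apply, ← LinearMap.baseChange_comp,
      show d.boundary ∘ₗ d.restrict = 0 from LinearMap.ext d.boundary_restrict]
    simp

theorem exact_baseChange_boundary_augmentation (d : MagnusDerivation p x N.mkHom) :
    Function.Exact (d.boundary.baseChange ℚ_[p])
      (rationalAugmentation p (G ⧸ (N : Subgroup G))) := by
  intro f
  constructor
  · intro hf
    have key (f : ℚ_[p] ⊗[ℤ_[p]] ((G ⧸ (N : Subgroup G)) → ℤ_[p])) :
        d.boundary.baseChange ℚ_[p] (d.homotopy.baseChange ℚ_[p] f) =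
          f - rationalAugmentation p _ f ⊗ₜ Pi.single 1 1 := by
      induction f using TensorProduct.induction_on with
      | zero => simp
      | tmul c f =>
        rw [LinearMap.baseChange_tmul, LinearMap.baseChange_tmul, boundary_homotopy,
          TensorProduct.tmul_sub, rationalAugmentation_tmul, TensorProduct.tmul_smul,
          TensorProduct.smul_tmul', Algebra.smul_def, mul_comm c]
        rfl
      | add a b ha hb =>
        rw [map_add, map_add, map_add, ha, hb, TensorProduct.add_tmul]
        abel
    exact ⟨_, by rw [key, hf, TensorProduct.zero_tmul, sub_zero]⟩
  · rintro ⟨m, rfl⟩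
    have key : (Fintype.linearCombination ℤ_[p] fun _ => (1 : ℤ_[p])) ∘ₗ d.boundary = 0 := by
      refine d.linearMap_ext fun q i => ?_
      rw [LinearMap.comp_apply, boundary_leftTranslation_map_gen, map_sub,
        Fintype.linearCombination_apply_single, Fintype.linearCombination_apply_single, sub_self]
      rfl
    induction m using TensorProduct.induction_on with
    | zero => simp
    | tmul c m =>
      have h := LinearMap.congr_fun key m
      rw [LinearMap.comp_apply, Fintype.linearCombination_apply] at h
      simp only [smul_eq_mul, mul_one, LinearMap.zero_apply] at h
      rw [LinearMap.baseChange_tmul, rationalAugmentation_tmul, h]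
      simp
    | add a b ha hb => rw [map_add, map_add, ha, hb, add_zero]

end MagnusDerivation

theorem mainTheorem7 (p : ℕ) [Fact p.Prime] (hp : p ≠ 2)
    {G : Type u} [Group G] [TopologicalSpace G] [IsTopologicalGroup G] [CompactSpace G]
    [TotallyDisconnectedSpace G] [IsProP p G]
    (hfree : ∃ (n : ℕ) (x : Fin n → G), IsFreeProPOn p x)
    [MulDistribMulAction SigmaGroup G] [ContinuousConstSMul SigmaGroup G]
    (N : OpenNormalSubgroup G) [SigmaInvariant (N : Subgroup G)] :
    Nonempty (((nAbRepQ p N).asModule × VSign p (N : Subgroup G) 1)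
      ≃ₗ[MonoidAlgebra ℚ_[p] (Delta (N : Subgroup G))]
        ((Representation.trivial ℚ_[p] (Delta (N : Subgroup G)) ℚ_[p]).asModule ×
          (Fin (dSign p G 1) → VSign p (N : Subgroup G) 1) ×
          (Fin (dSign p G (-1)) → VSign p (N : Subgroup G) (-1)))) ∧
    ∃ (v : Fin (dSign p G 1) → ℚ_[p] ⊗[ℤ_[p]] NAb N)
      (w : Fin (dSign p G (-1)) → ℚ_[p] ⊗[ℤ_[p]] NAb N),
      (∀ i, nAbRepQ p N (deltaSigma (N : Subgroup G)) (v i) = v i) ∧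
      (∀ i, nAbRepQ p N (deltaSigma (N : Subgroup G)) (w i) = -w i) ∧
      Submodule.span (MonoidAlgebra ℚ_[p] (G ⧸ (N : Subgroup G)))
        ((nAbRepQuot p N).asModuleEquiv.symm ''
          (Set.range v ∪ Set.range w)) = ⊤ := by
  classical
  obtain ⟨n, x, hx⟩ := hfree
  have : Finite (G ⧸ (N : Subgroup G)) :=
    Subgroup.quotient_finite_of_isOpen _ N.toOpenSubgroup.isOpen
  let _ : Fintype (G ⧸ (N : Subgroup G)) := Fintype.ofFinite _
  have hQ : IsPGroup p (G ⧸ (N : Subgroup G)) := IsProP.isPGroup_quotient p N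
  obtain ⟨d⟩ := hx.nonempty_magnusDerivation hQ N.mkHom
  have hπ : ∀ (s : SigmaGroup) (g : G), N.mkHom (s • g) = s • N.mkHom g := fun s g => rfl
  obtain ⟨m, b, hb, hm1, hm2⟩ := d.exists_eigenbasis hp hQ hπ
  have : Finite (Delta (N : Subgroup G)) := Finite.of_equiv _ SemidirectProduct.equivProd.symm
  have : NeZero (Nat.card (Delta (N : Subgroup G)) : ℚ_[p]) :=
    ⟨Nat.cast_ne_zero.2 Nat.card_pos.ne'⟩
  -- the Magnus module over `ℚ_p` and its basis of translates of even and odd vectors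
  let ρ := (d.rep hπ).rational
  let ε : Fin (dSign p G 1) ⊕ Fin (dSign p G (-1)) → ℤˣ := Sum.elim (fun _ => 1) fun _ => -1
  have hσ (j) : ρ (deltaSigma (N : Subgroup G)) (1 ⊗ₜ m j) = (ε j : ℤ) • (1 ⊗ₜ m j) := by
    have h : d.rep hπ (deltaSigma (N : Subgroup G)) (m j) = d.sigmaMap sigma (m j) := by
      rw [MagnusDerivation.rep_apply, SemidirectProduct.left_inr, map_one]
      rfl
    rw [Representation.rational_tmul, h]
    rcases j with i | i
    · simp [ε, hm1]
    · simp [ε, hm2, TensorProduct.tmul_neg]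
  have hbρ (a) : b.baseChange ℚ_[p] a = ρ (SemidirectProduct.inl a.2) (1 ⊗ₜ m a.1) := by
    have h : d.rep hπ (SemidirectProduct.inl a.2) (m a.1) = b a := by
      rw [MagnusDerivation.rep_apply, SemidirectProduct.left_inl, hb]
      have h1 : d.sigmaMap 1 (m a.1) = m a.1 := by
        have := LinearMap.congr_fun (map_one (d.rep hπ)) (m a.1)
        rwa [MagnusDerivation.rep_apply, SemidirectProduct.one_left, map_one] at this
      exact congrArg _ h1
    rw [Module.Basis.baseChange_apply, Representation.rational_tmul, h]
  obtain ⟨e1⟩ := VSign.nonempty_pi_linearEquiv ρ ε (fun j => 1 ⊗ₜ m j) hσ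
    (b.baseChange ℚ_[p]) hbρ
  -- the group ring of `G / N` is the even induced representation
  let τ := (permRep ℤ_[p] (G ⧸ (N : Subgroup G))).rational
  obtain ⟨e2⟩ := VSign.nonempty_pi_linearEquiv (J := Unit) τ (fun _ => 1)
    (fun _ => 1 ⊗ₜ Pi.single 1 1)
    (fun _ => by
      rw [Representation.rational_tmul, permRep_single]
      simp)
    (((Pi.basisFun ℤ_[p] (G ⧸ (N : Subgroup G))).reindex (Equiv.punitProd _).symm).baseChange
      ℚ_[p])
    (fun a => by
      rw [Representation.rational_tmul, permRep_single, Module.Basis.baseChange_apply]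
      simp)
  let i := d.restrict.rational (fun a y => d.restrict_nAbRep hπ a y)
  let f := d.boundary.rational (fun a m => d.boundary_rep hπ a m)
  let g : τ.asModule →ₗ[MonoidAlgebra ℚ_[p] (Delta (N : Subgroup G))]
      (Representation.trivial ℚ_[p] (Delta (N : Subgroup G)) ℚ_[p]).asModule :=
    Representation.IntertwiningMap.equivLinearMapAsModule τ _
      { toLinearMap := rationalAugmentation p _
        isIntertwining' := fun a => LinearMap.ext fun f => rationalAugmentation_permRep a f }
  have hi : Function.Injective i := d.injective_baseChange_restrict
  have hg : Function.Surjective g := fun c =>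
    ⟨(c : ℚ_[p]) ⊗ₜ Pi.single 1 1, by
      refine (rationalAugmentation_tmul p _ _).trans ?_
      rw [Finset.sum_pi_single', if_pos (Finset.mem_univ _), PadicInt.coe_one]
      exact mul_one (M := ℚ_[p]) c⟩
  obtain ⟨e3⟩ := nonempty_prod_linearEquiv_of_exact (i := i) (f := f) (g := g) hi
    d.exact_baseChange_restrict_boundary d.exact_baseChange_boundary_augmentation hg
  refine ⟨⟨?_⟩, ?_⟩
  · let eP : VSign p (N : Subgroup G) 1 ≃ₗ[MonoidAlgebra ℚ_[p] (Delta (N : Subgroup G))]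
        τ.asModule :=
      (LinearEquiv.funUnique Unit (MonoidAlgebra ℚ_[p] (Delta (N : Subgroup G))) _).symm.trans e2
    let eM : ρ.asModule ≃ₗ[MonoidAlgebra ℚ_[p] (Delta (N : Subgroup G))]
        (Fin (dSign p G 1) → VSign p (N : Subgroup G) 1) ×
          (Fin (dSign p G (-1)) → VSign p (N : Subgroup G) (-1)) :=
      e1.symm.trans (LinearEquiv.sumPiEquivProdPi (MonoidAlgebra ℚ_[p] (Delta (N : Subgroup G)))
        _ _ fun j => VSign p (N : Subgroup G) (ε j))
    exact (LinearEquiv.prodCongr (LinearEquiv.refl _ _) eP).trans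
      (e3.trans (LinearEquiv.prodCongr (LinearEquiv.refl _ _) eM))
  · -- a retraction of the Magnus embedding maps the basis to generators
    obtain ⟨l, hl⟩ := IsSemisimpleModule.extension_property i hi LinearMap.id
    let r : ρ.IntertwiningMap (nAbRepQ p N) :=
      (Representation.IntertwiningMap.equivLinearMapAsModule ρ (nAbRepQ p N)).symm l
    have hr : Function.Surjective r := fun y => ⟨i y, LinearMap.congr_fun hl y⟩
    have hrσ (j) : nAbRepQ p N (deltaSigma (N : Subgroup G)) (r (1 ⊗ₜ m j)) =
        (ε j : ℤ) • r (1 ⊗ₜ m j) := by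
      rw [← r.isIntertwining, hσ, map_zsmul]
    refine ⟨fun i => r (1 ⊗ₜ m (Sum.inl i)), fun i => r (1 ⊗ₜ m (Sum.inr i)), fun i => ?_,
      fun i => ?_, ?_⟩
    · simpa [ε] using hrσ (Sum.inl i)
    · simpa [ε] using hrσ (Sum.inr i)
    · rw [Submodule.eq_top_iff']
      intro y
      obtain ⟨z, hz⟩ := hr ((nAbRepQuot p N).asModuleEquiv y)
      rw [← (nAbRepQuot p N).asModuleEquiv.symm_apply_apply y, ← hz,
        ← (b.baseChange ℚ_[p]).sum_repr z, map_sum, map_sum]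
      refine Submodule.sum_mem _ fun a _ => ?_
      have hmem : (nAbRepQuot p N).asModuleEquiv.symm (r (1 ⊗ₜ m a.1)) ∈
          Submodule.span (MonoidAlgebra ℚ_[p] (G ⧸ (N : Subgroup G)))
            ((nAbRepQuot p N).asModuleEquiv.symm ''
              (Set.range (fun i => r (1 ⊗ₜ m (Sum.inl i))) ∪
                Set.range fun i => r (1 ⊗ₜ m (Sum.inr i)))) := by
        refine Submodule.subset_span ⟨_, ?_, rfl⟩
        rcases a with ⟨i | i, q⟩
        · exact Or.inl ⟨i, rfl⟩
        · exact Or.inr ⟨i, rfl⟩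
      have := Submodule.smul_mem _ (MonoidAlgebra.single a.2
        ((b.baseChange ℚ_[p]).repr z a)) hmem
      rw [Representation.single_smul] at this
      rw [map_smul, hbρ, r.isIntertwining]
      exact this
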